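/- Let $k,n\ge 1$ and $\Theta=\mathbb{R}^k\times\mathbb{R}_+$. For $\theta=(\beta,\sigma^2)\in\Theta$ let $Q_\theta$ be the law of $(x,y)$ where $y=x'\beta+\epsilon$, $x\sim P=\mathcal N_k(0,\mathbb I_k)$ and $\epsilon\sim\mathcal N(0,\sigma^2)$ is independent of $x$. For a prior $\pi$ on $\Theta$ let $J(\pi)\subseteq\{1,\dots,k\}$ be the set of indices $j$ for which the marginal law of $\beta_j$ under $\pi$ is not $\delta_0$. For a dataset $D_n$ of $n$ observations, i.i.d. from $Q_\theta$ given $\theta$, let $$L^*(\pi,D_n)=\inf_{f}\ \mathbb E_\pi\big[L(f,\theta)\,\big|\,D_n\big],\qquad L(f,\theta)=\mathbb E_{Q_\theta}\big[(y-f(x))^2\big],$$ where the infimum is over measurable $f:\mathbb R^k\to\mathbb R$ and the expectation is under the posterior, and let $m(\pi)=\int Q_\theta^{\otimes n}\,\pi(d\theta)$ be the marginal law of the data. Fix $a_0>1$ and $b_0>0$. A prior $\pi$ has Normal-Inverse Gamma form with hyperparameters $(a_0,b_0,\gamma)$, $\gamma>0$, if $\sigma^2\sim\text{Inv-Gamma}(a_0,b_0)$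 (density $\frac{b_0^{a_0}}{\Gamma(a_0)}s^{-a_0-1}e^{-b_0/s}$ on $s>0$) and $\beta_{J(\pi)}\mid\sigma^2\sim\mathcal N\big(0,\frac{\sigma^2}{\gamma|J(\pi)|}\mathbb I\big)$. For a nonempty $J\subseteq\{1,\dots,k\}$ let $\pi_{J,\gamma}$ denote the prior of this form with $J(\pi_{J,\gamma})=J$. 1. For every nonempty $J$ with $n>|J|+1$ we have, for all $\gamma>0$, $\mathbb E_{\pi_{J,\gamma}}[\sigma^2]=\frac{b_0}{a_0-1}$, and $$\lim_{\gamma\downarrow 0}\ \mathbb E_{m(\pi_{J,\gamma})}\big[L^*(\pi_{J,\gamma},D_n)\big]=\frac{b_0}{a_0-1}\Big(1+\frac{|J|}{n-|J|-1}\Big).$$ 2. For all nonempty $J,J'$ with $|J'|<|J|$ and $n>|J|+1$ we have, for all sufficiently small $\gamma>0$, $$\mathbb E_{m(\pi_{J',\gamma})}\big[L^*(\pi_{J',\gamma},D_n)\big]<\mathbb E_{m(\pi_{J,\gamma})}\big[L^*(\pi_{J,\gamma},D_n)\big],$$ and the strict inequality also holds between the two limits in part 1. -/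

import Mathlib

open MeasureTheory ProbabilityTheory Filter Topology
open scoped ENNReal NNReal MatrixOrder

namespace ModelCompetition

/-- A covariate vector `x ∈ ℝᵏ`. -/
abbrev Cov (k : ℕ) : Type := EuclideanSpace ℝ (Fin k)

/-- The parameter space `ℝᵏ × ℝ₊` of pairs `θ = (β, σ²)`. -/
abbrev Param (k : ℕ) : Type := EuclideanSpace ℝ (Fin k) × ℝ≥0

/-- A dataset of `n` observations `(xᵢ, yᵢ)`. -/
abbrev Data (k n : ℕ) : Type := Fin n → Cov k × ℝ

/-- The law `Q_θ` of `(x, y)` with `y = x'β + ε`, where `x ∼ P` and `ε ∼ N(0, σ²)` are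
independent. -/
noncomputable def dgp {k : ℕ} (P : Measure (Cov k)) (θ : Param k) : Measure (Cov k × ℝ) :=
  (P.prod (gaussianReal 0 θ.2)).map (fun z => (z.1, inner ℝ z.1 θ.1 + z.2))

instance {k : ℕ} (P : Measure (Cov k)) [IsProbabilityMeasure P] (θ : Param k) :
    IsProbabilityMeasure (dgp P θ) :=
  Measure.isProbabilityMeasure_map (by fun_prop)

/-- `N(0, v)` is the law of `√v · u` with `u` standard normal. -/
theorem gaussianReal_eq_map (v : ℝ≥0) :
    gaussianReal 0 v = (gaussianReal 0 1).map (fun u => Real.sqrt v * u) := by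
  rw [gaussianReal_map_const_mul]
  congr 1
  · simp
  · ext; simp

theorem measurable_dgp {k : ℕ} (P : Measure (Cov k)) [IsProbabilityMeasure P] :
    Measurable (dgp P) := by
  have h : dgp P = fun θ : Param k => (P.prod (gaussianReal 0 1)).map
      (fun z => (z.1, inner ℝ z.1 θ.1 + Real.sqrt θ.2 * z.2)) := by
    funext θ
    have h1 : P.prod (gaussianReal 0 θ.2) = (P.prod (gaussianReal 0 1)).map
        (Prod.map id (fun u => Real.sqrt θ.2 * u)) := by
      rw [← Measure.map_prod_map _ _ measurable_id (by fun_prop), Measure.map_id,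
        ← gaussianReal_eq_map]
    rw [dgp, h1, Measure.map_map (by fun_prop) (by fun_prop)]
    rfl
  rw [h]
  refine Measure.measurable_of_measurable_coe _ fun s hs => ?_
  have hf : Measurable (fun q : Param k × (Cov k × ℝ) =>
      ((q.2.1, inner ℝ q.2.1 q.1.1 + Real.sqrt q.1.2 * q.2.2) : Cov k × ℝ)) := by fun_prop
  have h2 := measurable_measure_prodMk_left (ν := P.prod (gaussianReal 0 1)) (hf hs)
  convert h2 using 2 with θ
  rw [Measure.map_apply (by fun_prop) hs]
  rfl

theorem measurable_pi_dgp {k : ℕ} (n : ℕ) (P : Measure (Cov k)) [IsProbabilityMeasure P] :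
    Measurable (fun θ : Param k => Measure.pi (fun _ : Fin n => dgp P θ)) := by
  refine Measurable.measure_of_isPiSystem_of_isProbabilityMeasure generateFrom_pi.symm
    isPiSystem_pi ?_
  rintro _ ⟨s, hs, rfl⟩
  simp only [Measure.pi_pi]
  exact Finset.measurable_prod _ fun i _ =>
    (Measure.measurable_coe (show MeasurableSet (s i) from hs i (Set.mem_univ i))).comp (measurable_dgp P)

/-- The law of a dataset `D_n` of `n` i.i.d. draws from `Q_θ`, as a Markov kernel in `θ`. -/
noncomputable def dataKernel {k : ℕ} (n : ℕ) (P : Measure (Cov k)) [IsProbabilityMeasure P] :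
    Kernel (Param k) (Data k n) where
  toFun θ := Measure.pi (fun _ : Fin n => dgp P θ)
  measurable' := measurable_pi_dgp n P

instance {k : ℕ} (n : ℕ) (P : Measure (Cov k)) [IsProbabilityMeasure P] :
    IsMarkovKernel (dataKernel n P) :=
  ⟨fun θ => inferInstanceAs (IsProbabilityMeasure (Measure.pi (fun _ : Fin n => dgp P θ)))⟩

open Classical in
/-- The model `J(π)`: the indices `j` for which the marginal law of `β_j` is not `δ₀`. -/
noncomputable def model {k : ℕ} (π : Measure (Param k)) : Finset (Fin k) :=
  Finset.univ.filter (fun j => π.map (fun θ => θ.1 j) ≠ Measure.dirac 0)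

/-- The inverse gamma law on `ℝ₊`, with density
`b ^ a / Γ(a) * x ^ (-(a + 1)) * exp (-b / x)` on `x > 0`. -/
noncomputable def invGamma (a b : ℝ) : Measure ℝ≥0 :=
  ((volume.restrict (Set.Ioi (0 : ℝ))).withDensity (fun x =>
    ENNReal.ofReal (b ^ a / Real.Gamma a * x ^ (-(a + 1)) * Real.exp (-b / x)))).map Real.toNNReal

theorem measurable_isotropicGaussian (ι : Type) [Fintype ι] [DecidableEq ι] (c : ℝ≥0) :
    Measurable (fun s : ℝ≥0 => multivariateGaussian (0 : EuclideanSpace ℝ ι)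
      (((s / c : ℝ≥0) : ℝ) • (1 : Matrix ι ι ℝ))) := by
  have h : (fun s : ℝ≥0 => multivariateGaussian (0 : EuclideanSpace ℝ ι)
      (((s / c : ℝ≥0) : ℝ) • (1 : Matrix ι ι ℝ))) = fun s : ℝ≥0 =>
      (stdGaussian (EuclideanSpace ℝ ι)).map (fun u => Real.sqrt ((s / c : ℝ≥0) : ℝ) • u) := by
    funext s
    have hs : CFC.sqrt (((s / c : ℝ≥0) : ℝ) • (1 : Matrix ι ι ℝ))
        = Real.sqrt ((s / c : ℝ≥0) : ℝ) • (1 : Matrix ι ι ℝ) := by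
      refine CFC.sqrt_unique ?_ ?_
      · rw [smul_mul_smul_comm, Real.mul_self_sqrt (NNReal.coe_nonneg _), one_mul]
      · exact (Matrix.PosSemidef.one.smul (Real.sqrt_nonneg _)).nonneg
    rw [multivariateGaussian, hs]
    simp
  rw [h]
  refine Measure.measurable_of_measurable_coe _ fun s hs => ?_
  have hf : Measurable (fun q : ℝ≥0 × EuclideanSpace ℝ ι =>
      Real.sqrt ((q.1 / c : ℝ≥0) : ℝ) • q.2) := by fun_prop
  have h2 := measurable_measure_prodMk_left
    (ν := stdGaussian (EuclideanSpace ℝ ι)) (hf hs)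
  convert h2 using 2 with t
  rw [Measure.map_apply (by fun_prop) hs]
  rfl

/-- The conditional law `β_J | σ² ∼ N(0, σ² / (γ |J|) · I)`, as a Markov kernel in `σ²`. -/
noncomputable def coeffKernel {k : ℕ} (J : Finset (Fin k)) (γ : ℝ≥0) :
    Kernel ℝ≥0 (EuclideanSpace ℝ J) where
  toFun s := multivariateGaussian 0 (((s / (γ * J.card) : ℝ≥0) : ℝ) • (1 : Matrix J J ℝ))
  measurable' := measurable_isotropicGaussian J (γ * J.card)

instance {k : ℕ} (J : Finset (Fin k)) (γ : ℝ≥0) : IsMarkovKernel (coeffKernel J γ) :=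
  ⟨fun s => inferInstanceAs (IsProbabilityMeasure (multivariateGaussian
    (0 : EuclideanSpace ℝ J) (((s / (γ * J.card) : ℝ≥0) : ℝ) • (1 : Matrix J J ℝ))))⟩

/-- The prior `π` has Normal-Inverse Gamma form with hyperparameters `(a, b, γ)`: under `π`,
`σ² ∼ Inv-Gamma(a, b)` and `β_{J(π)} | σ² ∼ N(0, σ² / (γ |J(π)|) · I)`. The coefficients outside
`J(π)` vanish almost surely by the definition of `J(π)`. -/
def HasNIGForm {k : ℕ} (a b : ℝ) (γ : ℝ≥0) (π : Measure (Param k)) : Prop :=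
  π.map (fun θ => (θ.2, WithLp.toLp 2 (fun j : model π => θ.1 j)))
    = (invGamma a b) ⊗ₘ (coeffKernel (model π) γ)

/-- The quadratic loss `L(f, θ) = E_{Q_θ}[(y - f(x))²]` of a prediction function `f`. -/
noncomputable def loss {k : ℕ} (P : Measure (Cov k)) (f : Cov k → ℝ) (θ : Param k) : ℝ≥0∞ :=
  ∫⁻ z, ENNReal.ofReal ((z.2 - f z.1) ^ 2) ∂(dgp P θ)

/-- The optimal posterior loss `L*(π, D_n) = min_f E_π[L(f, θ) | D_n]` over prediction
functions `f`. -/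
noncomputable def posteriorLoss {k n : ℕ} (P : Measure (Cov k)) [IsProbabilityMeasure P]
    (π : Measure (Param k)) [IsProbabilityMeasure π] (D : Data k n) : ℝ≥0∞ :=
  ⨅ (f : Cov k → ℝ) (_ : Measurable f), ∫⁻ θ, loss P f θ ∂(posterior (dataKernel n P) π D)

/-- The marginal law `m(π) = ∫ Q_θⁿ dπ(θ)` of the dataset according to an agent with prior `π`. -/
noncomputable def marginal {k : ℕ} (n : ℕ) (P : Measure (Cov k)) [IsProbabilityMeasure P]
    (π : Measure (Param k)) : Measure (Data k n) :=
  π.bind (dataKernel n P)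

/-- The ex-ante Bayes risk `E_{m(π)}[L*(π, D_n)]`. -/
noncomputable def exAnteRisk {k : ℕ} (n : ℕ) (P : Measure (Cov k)) [IsProbabilityMeasure P]
    (π : Measure (Param k)) [IsProbabilityMeasure π] : ℝ≥0∞ :=
  ∫⁻ D, posteriorLoss P π D ∂(marginal n P π)

end ModelCompetition

open ModelCompetition

/-!
Write `p = |J|`, `l = γ p`, let `M` be the `n × p` design matrix of the covariates in `J`, and let
`S = MᵀM + l I` (`ridgeGram`).

**The optimal prediction.** In terms of the normalised coefficients and errors, which form a
standard normal vector `z` given `σ²` and the covariates, the error of the ridge estimator is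
`σ S⁻¹ A z` with `A = [√l I, -Mᵀ]` and `A Aᵀ = S`. The reflection `1 - 2 Aᵀ S⁻¹ A` is orthogonal,
so it preserves the law of `z`; it leaves the responses unchanged and maps the coefficients to
their mirror image about the ridge estimator. Hence almost every posterior is symmetric about the
ridge estimator (`HasNIGForm.posterior_reflectParam`), and the parallelogram inequality shows that
no prediction function improves on the linear one with the ridge estimator as coefficients
(`HasNIGForm.posteriorLoss_eq`). This works with integrals of nonnegative functions throughout: no
posterior density and no posterior mean is computed. As `E |S⁻¹ A z|² = tr S⁻¹` and the covariates
are isotropic, the ex-ante risk is `E[σ²] (1 + E tr S⁻¹)` (`HasNIGForm.exAnteRisk_eq`).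

**The limit.** Stein's identity for the rows of `M`, applied to the vector field `M S⁻¹`, gives
`(n - p - 1) E tr S⁻¹ = p - l E[tr S⁻¹ + (tr S⁻¹)² + tr S⁻²]` (`integral_trace_inv_ridgeGram`).
All terms of the remainder are nonnegative, so `E tr S⁻¹ ≤ p / (n - p - 1)`. Since `tr S⁻¹`
increases as `l` decreases, its supremum over `l > 0` is integrable, in particular almost surely
finite; invertibility of `MᵀM` is thus never needed. From `l tr S⁻¹ ≤ p` and dominated convergence
the remainder tends to zero, and `E tr S⁻¹` tends to `p / (n - p - 1)`
(`tendsto_lintegral_trace_inv_ridgeGram`). The comparison of two models follows from the strict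
inequality of the limits.
-/

namespace ModelCompetition

open Matrix

/-- The law of a vector of independent standard normal variables indexed by `κ`. -/
noncomputable abbrev stdNormal (κ : Type*) [Fintype κ] : Measure (κ → ℝ) :=
  Measure.pi fun _ : κ => gaussianReal 0 1

/-! ### Standard normal vectors -/

section Gaussian

variable {κ : Type*} [Fintype κ]

theorem lintegral_inner_sq_stdGaussian {E : Type*} [NormedAddCommGroup E] [InnerProductSpace ℝ E]
    [FiniteDimensional ℝ E] [MeasurableSpace E] [BorelSpace E] (v : E) :
    ∫⁻ x, ENNReal.ofReal ((inner ℝ x v) ^ 2) ∂(stdGaussian E) = ENNReal.ofReal (‖v‖ ^ 2) := by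
  have hL : MemLp (innerSL ℝ v) 2 (stdGaussian E) := IsGaussian.memLp_dual _ _ _ (by simp)
  have h := hL.ofReal_variance_eq
  rw [variance_dual_stdGaussian, evariance_eq_lintegral_ofReal,
    integral_strongDual_stdGaussian, innerSL_apply_norm] at h
  rw [h]
  simp [real_inner_comm]

theorem lintegral_dotProduct_sq_stdNormal (b : κ → ℝ) :
    ∫⁻ z, ENNReal.ofReal ((b ⬝ᵥ z) ^ 2) ∂(stdNormal κ) = ENNReal.ofReal (∑ k, b k ^ 2) := by
  have h := lintegral_inner_sq_stdGaussian (WithLp.toLp 2 b : EuclideanSpace ℝ κ)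
  rw [← map_pi_eq_stdGaussian, lintegral_map (by fun_prop) (by fun_prop),
    EuclideanSpace.real_norm_sq_eq] at h
  simpa [EuclideanSpace.inner_toLp_toLp] using h

theorem lintegral_sum_mulVec_sq_stdNormal {ι : Type*} [Fintype ι] (B : Matrix ι κ ℝ) :
    ∫⁻ z, ENNReal.ofReal (∑ j, (B *ᵥ z) j ^ 2) ∂(stdNormal κ)
      = ENNReal.ofReal (B * Bᵀ).trace := by
  simp_rw [ENNReal.ofReal_sum_of_nonneg (fun _ _ => sq_nonneg _)]
  rw [lintegral_finsetSum _ (fun j _ => by unfold mulVec dotProduct; fun_prop)]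
  simp_rw [mulVec, lintegral_dotProduct_sq_stdNormal]
  rw [← ENNReal.ofReal_sum_of_nonneg (fun _ _ => by positivity)]
  simp [Matrix.trace, Matrix.mul_apply, sq]

/-- The standard normal law is invariant under orthogonal matrices. -/
theorem measurePreserving_mulVec_stdNormal [DecidableEq κ] {R : Matrix κ κ ℝ} (hR : Rᵀ * R = 1) :
    MeasurePreserving (R *ᵥ ·) (stdNormal κ) (stdNormal κ) := by
  have hm : Measurable (R *ᵥ · : (κ → ℝ) → κ → ℝ) := by
    exact (by fun_prop : Continuous (R *ᵥ · : (κ → ℝ) → κ → ℝ)).measurable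
  refine ⟨hm, ?_⟩
  let f : EuclideanSpace ℝ κ →ₗᵢ[ℝ] EuclideanSpace ℝ κ :=
    { toLinearMap := Matrix.toEuclideanLin R
      norm_map' := fun x => by
        rw [← sq_eq_sq₀ (norm_nonneg _) (norm_nonneg _), EuclideanSpace.real_norm_sq_eq,
          EuclideanSpace.real_norm_sq_eq]
        have h : (R *ᵥ x.ofLp) ⬝ᵥ (R *ᵥ x.ofLp) = x.ofLp ⬝ᵥ x.ofLp := by
          rw [dotProduct_mulVec, vecMul_mulVec, hR, vecMul_one]
        simpa [dotProduct, ← sq] using h }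
  have hf := stdGaussian_map (f.toLinearIsometryEquiv rfl)
  rw [← map_pi_eq_stdGaussian, Measure.map_map (by fun_prop) (by fun_prop)] at hf
  have h2 := congrArg (Measure.map (WithLp.ofLp : EuclideanSpace ℝ κ → κ → ℝ)) hf
  rw [Measure.map_map (by fun_prop) (by fun_prop),
    Measure.map_map (by fun_prop) (by fun_prop)] at h2
  have e2 : (WithLp.ofLp : EuclideanSpace ℝ κ → κ → ℝ) ∘ WithLp.toLp 2 = id := rfl
  rw [e2, Measure.map_id] at h2
  exact h2

end Gaussian

/-! ### Regularised Gram matrices -/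

section Gram

variable {ι m : Type*} [Fintype ι] [DecidableEq ι] [Fintype m]

/-- The regularised Gram matrix `MᵀM + l I` of ridge regression on the design matrix `M`. -/
def ridgeGram (M : Matrix m ι ℝ) (l : ℝ) : Matrix ι ι ℝ := Mᵀ * M + l • 1

theorem posDef_ridgeGram (M : Matrix m ι ℝ) {l : ℝ} (hl : 0 < l) : (ridgeGram M l).PosDef := by
  have h := Matrix.posSemidef_conjTranspose_mul_self M
  rw [conjTranspose_eq_transpose_of_trivial] at h
  exact Matrix.PosDef.posSemidef_add h (Matrix.PosDef.one.smul hl)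

theorem isUnit_det_ridgeGram (M : Matrix m ι ℝ) {l : ℝ} (hl : 0 < l) :
    IsUnit (ridgeGram M l).det :=
  (posDef_ridgeGram M hl).det_pos.ne'.isUnit

omit [Fintype ι] in
theorem transpose_ridgeGram (M : Matrix m ι ℝ) (l : ℝ) : (ridgeGram M l)ᵀ = ridgeGram M l := by
  simp [ridgeGram]

theorem transpose_inv_ridgeGram (M : Matrix m ι ℝ) (l : ℝ) :
    ((ridgeGram M l)⁻¹)ᵀ = (ridgeGram M l)⁻¹ := by
  rw [transpose_nonsing_inv, transpose_ridgeGram]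

/-- For invertible `A Aᵀ`, the reflection `1 - 2 Aᵀ (A Aᵀ)⁻¹ A` across the kernel of `A`. -/
theorem orthogonal_reflection {κ : Type*} [Fintype κ] [DecidableEq κ] (A : Matrix ι κ ℝ)
    (h : IsUnit (A * Aᵀ).det) :
    (1 - (2 : ℝ) • (Aᵀ * (A * Aᵀ)⁻¹ * A))ᵀ * (1 - (2 : ℝ) • (Aᵀ * (A * Aᵀ)⁻¹ * A)) = 1 := by
  set T := (A * Aᵀ)⁻¹ with hT
  have hTt : Tᵀ = T := by simp [hT, transpose_nonsing_inv]
  have hQ : (Aᵀ * T * A) * (Aᵀ * T * A) = Aᵀ * T * A := by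
    calc _ = Aᵀ * (T * (A * Aᵀ)) * T * A := by simp only [Matrix.mul_assoc]
      _ = _ := by rw [hT, nonsing_inv_mul _ h, Matrix.mul_one]
  have hQt : (Aᵀ * T * A)ᵀ = Aᵀ * T * A := by simp [hTt, Matrix.mul_assoc]
  rw [transpose_sub, transpose_smul, hQt, transpose_one, Matrix.sub_mul, Matrix.mul_sub,
    Matrix.mul_sub, smul_mul_smul_comm, hQ]
  simp only [Matrix.one_mul, Matrix.mul_one]
  module

end Gram

/-- The coefficient vector with entries `v` on `J` and zero elsewhere. -/
noncomputable def zeroExtend {k : ℕ} (J : Finset (Fin k)) (v : J → ℝ) : Cov k :=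
  WithLp.toLp 2 fun j => if h : j ∈ J then v ⟨j, h⟩ else 0

/-- The design matrix of the covariates in `J`, with one row per observation. -/
def design {k n : ℕ} (J : Finset (Fin k)) (X : Fin n → Cov k) : Matrix (Fin n) J ℝ :=
  Matrix.of fun i j => X i j

/-- The dataset with covariates `X`, coefficients `β` and errors `ε`. -/
noncomputable def sample {k n : ℕ} (X : Fin n → Cov k) (β : Cov k) (ε : Fin n → ℝ) : Data k n :=
  fun i => (X i, inner ℝ (X i) β + ε i)

/-! ### Coefficients supported on a model -/

section ZeroExtend

variable {k : ℕ} (J : Finset (Fin k))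

@[fun_prop]
theorem measurable_zeroExtend : Measurable (zeroExtend J) := by
  unfold zeroExtend
  refine (WithLp.measurable_toLp 2 _).comp (measurable_pi_lambda _ fun j => ?_)
  by_cases h : j ∈ J
  · simpa [h] using measurable_pi_apply _
  · simp [h]

theorem inner_zeroExtend (x : Cov k) (v : J → ℝ) :
    inner ℝ x (zeroExtend J v) = ∑ j : J, x j * v j := by
  rw [PiLp.inner_apply, ← Finset.sum_subset (Finset.subset_univ J), ← Finset.sum_coe_sort J]
  · simp [zeroExtend, mul_comm]
  · intro j _ hj
    simp [zeroExtend, hj]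

theorem inner_zeroExtend_eq_mulVec {n : ℕ} (X : Fin n → Cov k) (v : J → ℝ) (i : Fin n) :
    inner ℝ (X i) (zeroExtend J v) = (design J X *ᵥ v) i :=
  inner_zeroExtend J (X i) v

theorem norm_sq_zeroExtend (v : J → ℝ) : ‖zeroExtend J v‖ ^ 2 = ∑ j, v j ^ 2 := by
  rw [← real_inner_self_eq_norm_sq, inner_zeroExtend]
  simp [zeroExtend, sq]

theorem zeroExtend_sub (v w : J → ℝ) : zeroExtend J (v - w) = zeroExtend J v - zeroExtend J w := by
  ext j
  by_cases h : j ∈ J <;> simp [zeroExtend, h]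

theorem zeroExtend_smul (c : ℝ) (v : J → ℝ) : zeroExtend J (c • v) = c • zeroExtend J v := by
  ext j
  by_cases h : j ∈ J <;> simp [zeroExtend, h]

end ZeroExtend

instance (a b : ℝ) : SFinite (invGamma a b) := by
  unfold invGamma; infer_instance

/-! ### The joint law of parameters and data -/

section Joint

variable {k n : ℕ} {P : Measure (Cov k)} [IsProbabilityMeasure P]

@[fun_prop]
theorem measurable_sample :
    Measurable fun q : (Fin n → Cov k) × Cov k × (Fin n → ℝ) => sample q.1 q.2.1 q.2.2 := by
  unfold sample; fun_prop

theorem dgp_eq_map (θ : Param k) :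
    dgp P θ = (P.prod (gaussianReal 0 1)).map
      (fun z => (z.1, inner ℝ z.1 θ.1 + Real.sqrt θ.2 * z.2)) := by
  have h1 : P.prod (gaussianReal 0 θ.2) = (P.prod (gaussianReal 0 1)).map
      (Prod.map id (fun u => Real.sqrt θ.2 * u)) := by
    rw [← Measure.map_prod_map _ _ measurable_id (by fun_prop), Measure.map_id,
      ← gaussianReal_eq_map]
  rw [dgp, h1, Measure.map_map (by fun_prop) (by fun_prop)]
  rfl

/-- Given `θ`, a dataset is a function of the covariates and of independent standard normal
errors. -/
theorem lintegral_dataKernel (θ : Param k) {F : Data k n → ℝ≥0∞} (hF : Measurable F) :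
    ∫⁻ D, F D ∂(dataKernel n P θ)
      = ∫⁻ X, ∫⁻ e, F (sample X θ.1 (Real.sqrt θ.2 • e)) ∂(stdNormal (Fin n))
          ∂(Measure.pi fun _ : Fin n => P) := by
  have h0 : dataKernel n P θ = Measure.pi (fun _ : Fin n => dgp P θ) := rfl
  set g : Cov k × ℝ → Cov k × ℝ := fun z => (z.1, inner ℝ z.1 θ.1 + Real.sqrt θ.2 * z.2) with hg
  have hgm : Measurable g := by fun_prop
  have hprob : IsProbabilityMeasure ((P.prod (gaussianReal 0 1)).map g) :=
    Measure.isProbabilityMeasure_map hgm.aemeasurable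
  have h1 : dataKernel n P θ = (Measure.pi fun _ : Fin n => P.prod (gaussianReal 0 1)).map
      (fun z i => g (z i)) := by
    rw [h0, Measure.pi_map_pi (fun _ => hgm.aemeasurable)]
    simp_rw [dgp_eq_map, hg]
  have hgm' : Measurable (fun (z : Fin n → Cov k × ℝ) i => g (z i)) := by fun_prop
  rw [h1, lintegral_map hF hgm']
  have hmp := measurePreserving_arrowProdEquivProdArrow (Cov k) ℝ (Fin n) (fun _ => P)
    (fun _ => gaussianReal 0 1)
  have h2 := hmp.symm.lintegral_comp (hF.comp hgm')
  simp only [Function.comp_apply] at h2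
  rw [← h2, lintegral_prod]
  · rfl
  · exact ((hF.comp hgm').comp (MeasurableEquiv.measurable _)).aemeasurable

theorem coeffKernel_eq_map (J : Finset (Fin k)) (γ s : ℝ≥0) :
    coeffKernel J γ s = (stdNormal J).map
      (fun u => WithLp.toLp 2 ((Real.sqrt s / Real.sqrt (γ * J.card)) • u)) := by
  have h0 : coeffKernel J γ s = multivariateGaussian 0
    (((s / (γ * J.card) : ℝ≥0) : ℝ) • (1 : Matrix J J ℝ)) := rfl
  have hs : CFC.sqrt (((s / (γ * J.card) : ℝ≥0) : ℝ) • (1 : Matrix J J ℝ))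
      = Real.sqrt ((s / (γ * J.card) : ℝ≥0) : ℝ) • (1 : Matrix J J ℝ) := by
    refine CFC.sqrt_unique ?_ ?_
    · rw [smul_mul_smul_comm, Real.mul_self_sqrt (NNReal.coe_nonneg _), one_mul]
    · exact (Matrix.PosSemidef.one.smul (Real.sqrt_nonneg _)).nonneg
  rw [h0, multivariateGaussian, hs, ← map_pi_eq_stdGaussian,
    Measure.map_map (by fun_prop) (by fun_prop)]
  congr 1
  ext u : 1
  simp [Real.sqrt_div]

/-- Under a prior of Normal-Inverse Gamma form, `θ` is a function of `σ²` and of independent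
standard normal variables. -/
theorem HasNIGForm.lintegral_eq {a b : ℝ} {γ : ℝ≥0} {π : Measure (Param k)}
    (h : HasNIGForm a b γ π) {J : Finset (Fin k)} (hJ : model π = J) {G : Param k → ℝ≥0∞}
    (hG : Measurable G) :
    ∫⁻ θ, G θ ∂π = ∫⁻ s, ∫⁻ u,
      G (zeroExtend J ((Real.sqrt s / Real.sqrt (γ * J.card)) • u), s) ∂(stdNormal J)
        ∂(invGamma a b) := by
  subst hJ
  -- Only the coefficients in the model enter the hypothesis; the others vanish almost surely.
  have h0 : ∀ᵐ θ ∂π, zeroExtend (model π) (fun j => θ.1 j) = θ.1 := by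
    have h1 : ∀ j, ∀ᵐ θ ∂π, j ∉ model π → θ.1 j = 0 := by
      intro j
      by_cases hj : j ∈ model π
      · simp [hj]
      · have h2 : π.map (fun θ => θ.1 j) = Measure.dirac 0 := by
          by_contra hne
          exact hj (by simp [model, hne])
        have h3 : ∀ᵐ x ∂(π.map (fun θ => θ.1 j)), x = 0 := by
          rw [h2]; simp [ae_dirac_eq]
        filter_upwards [ae_of_ae_map (by fun_prop) h3] with θ hθ _ using hθ
    filter_upwards [ae_all_iff.2 h1] with θ hθ
    ext j
    by_cases hj : j ∈ model π
    · simp [zeroExtend, hj]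
    · simp [zeroExtend, hj, hθ j hj]
  have hG' : Measurable fun q : ℝ≥0 × EuclideanSpace ℝ (model π) =>
      G (zeroExtend (model π) (fun j => q.2 j), q.1) := by fun_prop
  calc ∫⁻ θ, G θ ∂π = ∫⁻ θ, G (zeroExtend (model π) (fun j => θ.1 j), θ.2) ∂π := by
        refine lintegral_congr_ae ?_
        filter_upwards [h0] with θ hθ
        rw [hθ]
    _ = ∫⁻ q, G (zeroExtend (model π) (fun j => q.2 j), q.1)
          ∂(π.map (fun θ => (θ.2, WithLp.toLp 2 (fun j : model π => θ.1 j)))) := by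
        rw [lintegral_map hG' (by fun_prop)]
    _ = _ := by
        rw [h, Measure.lintegral_compProd hG']
        refine lintegral_congr fun s => ?_
        rw [coeffKernel_eq_map, lintegral_map (by fun_prop) (by fun_prop)]

/-- The joint law of `(θ, D_n)` in terms of `σ²`, the covariates `X` and a standard normal vector
`z`, which holds the normalised coefficients followed by the normalised errors. -/
theorem HasNIGForm.lintegral_joint {a b : ℝ} {γ : ℝ≥0} {π : Measure (Param k)}
    [IsProbabilityMeasure π]
    (h : HasNIGForm a b γ π) {J : Finset (Fin k)} (hJ : model π = J)
    {F : Param k × Data k n → ℝ≥0∞} (hF : Measurable F) :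
    ∫⁻ q, F q ∂(π ⊗ₘ dataKernel n P) = ∫⁻ s, ∫⁻ X, ∫⁻ z : J ⊕ Fin n → ℝ,
      F ((zeroExtend J ((Real.sqrt s / Real.sqrt (γ * J.card)) • (z ∘ Sum.inl)), s),
        sample X (zeroExtend J ((Real.sqrt s / Real.sqrt (γ * J.card)) • (z ∘ Sum.inl)))
          (Real.sqrt s • (z ∘ Sum.inr)))
        ∂(stdNormal (J ⊕ Fin n)) ∂(Measure.pi fun _ : Fin n => P) ∂(invGamma a b) := by
  rw [Measure.lintegral_compProd hF, h.lintegral_eq hJ hF.lintegral_kernel_prod_right']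
  refine lintegral_congr fun s => ?_
  set t : ℝ := Real.sqrt s / Real.sqrt (γ * J.card)
  have hm : Measurable fun q : (J → ℝ) × (Fin n → Cov k) × (Fin n → ℝ) =>
      F ((zeroExtend J (t • q.1), s),
        sample q.2.1 (zeroExtend J (t • q.1)) (Real.sqrt s • q.2.2)) := by
    fun_prop
  have h1 : ∀ u : J → ℝ, ∫⁻ D, F ((zeroExtend J (t • u), s), D)
        ∂(dataKernel n P (zeroExtend J (t • u), s))
      = ∫⁻ X, ∫⁻ e, F ((zeroExtend J (t • u), s),
          sample X (zeroExtend J (t • u)) (Real.sqrt s • e)) ∂(stdNormal (Fin n))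
          ∂(Measure.pi fun _ : Fin n => P) := fun u =>
    lintegral_dataKernel (P := P) (zeroExtend J (t • u), s)
      (F := fun D => F ((zeroExtend J (t • u), s), D)) (by fun_prop)
  simp_rw [h1]
  rw [lintegral_lintegral_swap]
  · refine lintegral_congr fun X => ?_
    have hmp := measurePreserving_sumPiEquivProdPi
      (fun _ : J ⊕ Fin n => gaussianReal 0 1)
    have hX : Measurable fun q : (J → ℝ) × (Fin n → ℝ) =>
      F ((zeroExtend J (t • q.1), s), sample X (zeroExtend J (t • q.1)) (Real.sqrt s • q.2)) := by
      exact hm.comp (measurable_fst.prodMk (measurable_const.prodMk measurable_snd))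
    have h2 := hmp.lintegral_comp hX
    rw [lintegral_prod _ hX.aemeasurable] at h2
    exact h2.symm
  · have hm' : Measurable fun q : ((J → ℝ) × (Fin n → Cov k)) × (Fin n → ℝ) =>
      F ((zeroExtend J (t • q.1.1), s),
        sample q.1.2 (zeroExtend J (t • q.1.1)) (Real.sqrt s • q.2)) := by
      exact hm.comp (by fun_prop : Measurable fun q : ((J → ℝ) × (Fin n → Cov k)) × (Fin n → ℝ) =>
        (q.1.1, q.1.2, q.2))
    exact hm'.lintegral_prod_right'.aemeasurable

end Joint

/-! ### The mean of the inverse gamma law -/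

theorem lintegral_invGamma {a b : ℝ} (ha : 1 < a) (hb : 0 < b) :
    ∫⁻ s, (s : ℝ≥0∞) ∂(invGamma a b) = ENNReal.ofReal (b / (a - 1)) := by
  have hΓ : 0 < Real.Gamma (a - 1) := Real.Gamma_pos_of_pos (by linarith)
  have himg : (fun x : ℝ => x⁻¹) '' Set.Ioi 0 = Set.Ioi 0 := by
    ext x
    constructor
    · rintro ⟨y, hy, rfl⟩
      exact Set.mem_Ioi.2 (inv_pos.2 (Set.mem_Ioi.1 hy))
    · intro hx
      exact ⟨x⁻¹, Set.mem_Ioi.2 (inv_pos.2 (Set.mem_Ioi.1 hx)), inv_inv x⟩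
  have hI : ∫ t in Set.Ioi (0 : ℝ), t ^ ((a - 1) - 1) * Real.exp (-(b * t))
      = (1 / b) ^ (a - 1) * Real.Gamma (a - 1) :=
    Real.integral_rpow_mul_exp_neg_mul_Ioi (by linarith) hb
  have hint : IntegrableOn (fun t : ℝ => t ^ ((a - 1) - 1) * Real.exp (-(b * t))) (Set.Ioi 0) := by
    by_contra hn
    rw [integral_undef hn] at hI
    have : 0 < (1 / b) ^ (a - 1) * Real.Gamma (a - 1) := by positivity
    exact this.ne hI
  have hG : Real.Gamma a = (a - 1) * Real.Gamma (a - 1) := by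
    have := Real.Gamma_add_one (s := a - 1) (by linarith)
    simpa using this
  rw [invGamma, lintegral_map (by fun_prop) (by fun_prop),
    lintegral_withDensity_eq_lintegral_mul _ (by fun_prop) (by fun_prop)]
  -- The substitution `x ↦ x⁻¹` turns the mean into a gamma integral with shape `a - 1`.
  nth_rewrite 1 [← himg]
  rw [lintegral_image_eq_lintegral_abs_deriv_mul measurableSet_Ioi
    (f' := fun x => -(x ^ 2)⁻¹) (fun x hx => (hasDerivAt_inv hx.ne').hasDerivWithinAt)
    inv_injective.injOn]
  have hpt : ∀ x ∈ Set.Ioi (0 : ℝ), ENNReal.ofReal |-(x ^ 2)⁻¹| *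
      ((fun x => ENNReal.ofReal (b ^ a / Real.Gamma a * x ^ (-(a + 1)) * Real.exp (-b / x))) *
        fun x : ℝ => ((x.toNNReal : ℝ≥0) : ℝ≥0∞)) x⁻¹
      = ENNReal.ofReal (b ^ a / Real.Gamma a * (x ^ ((a - 1) - 1) * Real.exp (-(b * x)))) := by
    intro x hx
    have hx : 0 < x := hx
    have hG' : 0 < Real.Gamma a := Real.Gamma_pos_of_pos (by linarith)
    simp only [Pi.mul_apply]
    change _ * (_ * ENNReal.ofReal x⁻¹) = _
    rw [← ENNReal.ofReal_mul (by positivity), ← ENNReal.ofReal_mul (by positivity)]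
    congr 1
    have e1 : (x⁻¹) ^ (-(a + 1)) = x ^ (a - 1 - 1) * x ^ 3 := by
      rw [Real.inv_rpow hx.le, ← Real.rpow_neg hx.le, ← Real.rpow_natCast, ← Real.rpow_add hx]
      congr 1; push_cast; ring
    rw [e1, abs_neg, abs_of_pos (by positivity)]
    rw [div_inv_eq_mul, neg_mul]
    field_simp
  rw [setLIntegral_congr_fun measurableSet_Ioi hpt, ← ofReal_integral_eq_lintegral_ofReal
    (hint.const_mul _), integral_const_mul, hI]
  · congr 1
    rw [hG, Real.div_rpow zero_le_one hb.le, Real.one_rpow]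
    have : b ^ a = b ^ (a - 1) * b := by
      rw [← Real.rpow_add_one hb.ne']; simp
    rw [this]
    have := Real.rpow_pos_of_pos hb (a - 1)
    field_simp
  · refine (ae_restrict_iff' measurableSet_Ioi).2 (ae_of_all _ fun x hx => ?_)
    have hG' : 0 < Real.Gamma a := Real.Gamma_pos_of_pos (by linarith)
    have hx : 0 < x := hx
    simp only [Pi.zero_apply]
    positivity

/-! ### The reflection about the ridge estimator -/

section Reflection

variable {ι m : Type*} [Fintype ι] [DecidableEq ι] [Fintype m]

/-- The matrix `[r I, -Mᵀ]`, which sends the normalised coefficients and errors to a multiple of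
the score of the ridge regression; its Gram matrix is `ridgeGram M (r ^ 2)`. -/
def scoreMatrix (M : Matrix m ι ℝ) (r : ℝ) : Matrix ι (ι ⊕ m) ℝ :=
  Matrix.fromCols (r • 1) (-Mᵀ)

theorem scoreMatrix_mul_transpose (M : Matrix m ι ℝ) (r : ℝ) :
    scoreMatrix M r * (scoreMatrix M r)ᵀ = ridgeGram M (r ^ 2) := by
  rw [scoreMatrix, transpose_fromCols, fromCols_mul_fromRows, ridgeGram]
  simp [smul_smul, sq, add_comm]

/-- The error of the ridge estimator is linear in the normalised coefficients and errors. -/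
theorem inv_ridgeGram_mulVec_sample (M : Matrix m ι ℝ) {r : ℝ} (hr : 0 < r) (σ : ℝ)
    (z : ι ⊕ m → ℝ) :
    (ridgeGram M (r ^ 2))⁻¹ *ᵥ (Mᵀ *ᵥ (M *ᵥ ((σ / r) • (z ∘ Sum.inl)) + σ • (z ∘ Sum.inr)))
      = (σ / r) • (z ∘ Sum.inl) - σ • ((ridgeGram M (r ^ 2))⁻¹ *ᵥ (scoreMatrix M r *ᵥ z)) := by
  have hS := isUnit_det_ridgeGram M (sq_pos_of_pos hr)
  have h1 : Mᵀ *ᵥ (M *ᵥ ((σ / r) • (z ∘ Sum.inl)) + σ • (z ∘ Sum.inr))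
      = ridgeGram M (r ^ 2) *ᵥ ((σ / r) • (z ∘ Sum.inl)) - σ • (scoreMatrix M r *ᵥ z) := by
    have h2 : scoreMatrix M r *ᵥ z = (r • 1 : Matrix ι ι ℝ) *ᵥ (z ∘ Sum.inl)
        + (-Mᵀ) *ᵥ (z ∘ Sum.inr) := by
      conv_lhs => rw [← Sum.elim_comp_inl_inr z]
      rw [scoreMatrix, fromCols_mulVec_sumElim]
    rw [h2, ridgeGram, add_mulVec, mulVec_add]
    simp only [mulVec_smul, smul_mulVec, one_mulVec, neg_mulVec, mulVec_mulVec]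
    have : σ / r * r ^ 2 = σ * r := by field_simp
    simp only [smul_add, smul_smul, smul_neg]
    rw [this]
    abel
  rw [h1, mulVec_sub, mulVec_mulVec, nonsing_inv_mul _ hS, one_mulVec, mulVec_smul]

variable [DecidableEq m]

/-- The reflection of the normalised coefficients and errors which fixes the responses and
reflects the coefficients about the ridge estimator. -/
noncomputable def ridgeReflection (M : Matrix m ι ℝ) (r : ℝ) : Matrix (ι ⊕ m) (ι ⊕ m) ℝ :=
  1 - (2 : ℝ) • ((scoreMatrix M r)ᵀ * (ridgeGram M (r ^ 2))⁻¹ * scoreMatrix M r)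

theorem ridgeReflection_orthogonal (M : Matrix m ι ℝ) {r : ℝ} (hr : 0 < r) :
    (ridgeReflection M r)ᵀ * ridgeReflection M r = 1 := by
  have h := orthogonal_reflection (scoreMatrix M r)
    (by rw [scoreMatrix_mul_transpose]; exact isUnit_det_ridgeGram M (sq_pos_of_pos hr))
  rwa [scoreMatrix_mul_transpose] at h

theorem ridgeReflection_mulVec (M : Matrix m ι ℝ) (r : ℝ) (z : ι ⊕ m → ℝ) :
    ridgeReflection M r *ᵥ z = Sum.elim
      (z ∘ Sum.inl - (2 * r) • ((ridgeGram M (r ^ 2))⁻¹ *ᵥ (scoreMatrix M r *ᵥ z)))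
      (z ∘ Sum.inr + (2 : ℝ) • (M *ᵥ ((ridgeGram M (r ^ 2))⁻¹ *ᵥ (scoreMatrix M r *ᵥ z)))) := by
  rw [ridgeReflection, sub_mulVec, one_mulVec, smul_mulVec, ← mulVec_mulVec, ← mulVec_mulVec]
  set w := (ridgeGram M (r ^ 2))⁻¹ *ᵥ (scoreMatrix M r *ᵥ z)
  rw [scoreMatrix, transpose_fromCols, fromRows_mulVec]
  ext (i | i)
  · simp [mul_assoc, smul_mulVec]
  · simp [neg_mulVec]

end Reflection

/-! ### Symmetry of the posterior -/

section Posterior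

variable {k n : ℕ}

/-- The ridge estimator of the coefficients in `J`, with penalty `l`. -/
noncomputable def ridgeEstimate (J : Finset (Fin k)) (l : ℝ) (D : Data k n) : J → ℝ :=
  (ridgeGram (design J fun i => (D i).1) l)⁻¹ *ᵥ
    ((design J fun i => (D i).1)ᵀ *ᵥ fun i => (D i).2)

theorem continuous_inv_ridgeGram {ι m : Type*} [Fintype ι] [DecidableEq ι] [Fintype m] {l : ℝ}
    (hl : 0 < l) : Continuous fun M : Matrix m ι ℝ => (ridgeGram M l)⁻¹ := by
  have h : Continuous fun M : Matrix m ι ℝ => ridgeGram M l := by unfold ridgeGram; fun_prop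
  simp_rw [Matrix.inv_def, Ring.inverse_eq_inv']
  exact (h.matrix_det.inv₀ fun M => (posDef_ridgeGram M hl).det_pos.ne').smul h.matrix_adjugate

@[fun_prop]
theorem continuous_design (J : Finset (Fin k)) :
    Continuous fun X : Fin n → Cov k => design J X := by
  unfold design
  exact continuous_matrix fun i j => by simp only [of_apply]; fun_prop

theorem measurable_ridgeEstimate (J : Finset (Fin k)) {l : ℝ} (hl : 0 < l) :
    Measurable (ridgeEstimate (n := n) J l) := by
  have h1 : Continuous fun D : Data k n => (ridgeGram (design J fun i => (D i).1) l)⁻¹ :=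
    (continuous_inv_ridgeGram hl).comp ((continuous_design J).comp (by fun_prop))
  have h2 : Continuous fun D : Data k n => (design J fun i => (D i).1)ᵀ :=
    ((continuous_design J).comp (by fun_prop)).matrix_transpose
  exact (h1.matrix_mulVec (h2.matrix_mulVec (by fun_prop))).measurable

/-- The reflection of the coefficients about the ridge estimator. -/
noncomputable def reflectParam (J : Finset (Fin k)) (l : ℝ) (D : Data k n) (θ : Param k) :
    Param k :=
  ((2 : ℝ) • zeroExtend J (ridgeEstimate J l D) - θ.1, θ.2)

theorem measurable_reflectParam (J : Finset (Fin k)) {l : ℝ} (hl : 0 < l) :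
    Measurable fun q : Data k n × Param k => reflectParam J l q.1 q.2 := by
  have := measurable_ridgeEstimate (n := n) J hl
  unfold reflectParam
  fun_prop

theorem measurable_reflectParam_apply (J : Finset (Fin k)) (l : ℝ) (D : Data k n) :
    Measurable (reflectParam J l D) := by
  unfold reflectParam
  fun_prop

variable {J : Finset (Fin k)} {r : ℝ}

theorem ridgeEstimate_sample (hr : 0 < r) (σ : ℝ) (X : Fin n → Cov k) (z : J ⊕ Fin n → ℝ) :
    ridgeEstimate J (r ^ 2)
        (sample X (zeroExtend J ((σ / r) • (z ∘ Sum.inl))) (σ • (z ∘ Sum.inr)))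
      = (σ / r) • (z ∘ Sum.inl)
        - σ • ((ridgeGram (design J X) (r ^ 2))⁻¹ *ᵥ (scoreMatrix (design J X) r *ᵥ z)) := by
  rw [← inv_ridgeGram_mulVec_sample _ hr]
  simp only [ridgeEstimate, sample, inner_zeroExtend_eq_mulVec]
  rfl

variable {P : Measure (Cov k)} [IsProbabilityMeasure P] {a b : ℝ} {γ : ℝ≥0}
  {π : Measure (Param k)} [IsProbabilityMeasure π]

/-- The joint law of `(θ, D_n)` is invariant under reflection of the coefficients about the ridge
estimator, since `ridgeReflection` preserves the law of the normalised coefficients and errors and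
leaves the data unchanged. -/
theorem HasNIGForm.lintegral_reflectParam (h : HasNIGForm a b γ π) (hJ : model π = J)
    (hr : r = Real.sqrt (γ * J.card)) (hr0 : 0 < r) {F : Param k × Data k n → ℝ≥0∞}
    (hF : Measurable F) :
    ∫⁻ q, F (reflectParam J (r ^ 2) q.2 q.1, q.2) ∂(π ⊗ₘ dataKernel n P)
      = ∫⁻ q, F q ∂(π ⊗ₘ dataKernel n P) := by
  have hT : Measurable fun q : Param k × Data k n =>
      F (reflectParam J (r ^ 2) q.2 q.1, q.2) := by
    have := (measurable_reflectParam (n := n) J (sq_pos_of_pos hr0)).comp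
      (measurable_swap (α := Param k))
    exact hF.comp (this.prodMk measurable_snd)
  rw [h.lintegral_joint hJ hF, h.lintegral_joint hJ hT, ← hr]
  refine lintegral_congr fun s => lintegral_congr fun X => ?_
  have hmp := measurePreserving_mulVec_stdNormal (ridgeReflection_orthogonal (design J X) hr0)
  have hm : Measurable fun z : J ⊕ Fin n → ℝ =>
      F ((zeroExtend J ((Real.sqrt s / r) • (z ∘ Sum.inl)), s),
        sample X (zeroExtend J ((Real.sqrt s / r) • (z ∘ Sum.inl)))
          (Real.sqrt s • (z ∘ Sum.inr))) := by
    have h1 : Measurable fun z : J ⊕ Fin n → ℝ => z ∘ Sum.inl := by fun_prop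
    have h2 : Measurable fun z : J ⊕ Fin n → ℝ => z ∘ Sum.inr := by fun_prop
    fun_prop
  rw [← hmp.lintegral_comp hm]
  refine lintegral_congr fun z => ?_
  have hrs : Real.sqrt s / r * (2 * r) = 2 * Real.sqrt s := by field_simp
  rw [reflectParam, ridgeEstimate_sample hr0, ridgeReflection_mulVec, Sum.elim_comp_inl,
    Sum.elim_comp_inr]
  set w := (ridgeGram (design J X) (r ^ 2))⁻¹ *ᵥ (scoreMatrix (design J X) r *ᵥ z)
  congr 2
  · congr 1
    rw [← zeroExtend_smul, ← zeroExtend_sub]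
    congr 1
    rw [smul_sub, smul_sub, smul_smul, smul_smul, smul_smul, hrs]
    module
  · ext1 i
    simp only [sample, inner_zeroExtend_eq_mulVec]
    congr 1
    simp only [smul_sub, smul_smul, hrs, mulVec_sub, mulVec_smul, Pi.add_apply,
      Pi.sub_apply, Pi.smul_apply, smul_eq_mul]
    ring

/-- The posterior is invariant under reflection of the coefficients about the ridge estimator. -/
theorem HasNIGForm.posterior_reflectParam (h : HasNIGForm a b γ π) (hJ : model π = J)
    (hr : r = Real.sqrt (γ * J.card)) (hr0 : 0 < r) :
    ∀ᵐ D ∂(marginal n P π), (posterior (dataKernel n P) π D).map (reflectParam J (r ^ 2) D)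
      = posterior (dataKernel n P) π D := by
  have hT := measurable_reflectParam (n := n) J (sq_pos_of_pos hr0)
  let η : Kernel (Data k n) (Param k) :=
    (Kernel.id ×ₖ posterior (dataKernel n P) π).map
      (fun q : Data k n × Param k => reflectParam J (r ^ 2) q.1 q.2)
  have hη : ∀ D, η D = (posterior (dataKernel n P) π D).map (reflectParam J (r ^ 2) D) := by
    intro D
    simp only [η]
    rw [Kernel.map_apply _ hT, Kernel.prod_apply, Kernel.id_apply, Measure.dirac_prod,
      Measure.map_map hT (by fun_prop)]
    rfl
  have : IsMarkovKernel η := Kernel.IsMarkovKernel.map _ hT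
  -- The reflected kernel disintegrates the same joint law, and posteriors are unique.
  have key : (dataKernel n P ∘ₘ π) ⊗ₘ η = (π ⊗ₘ dataKernel n P).map Prod.swap := by
    refine Measure.ext_of_lintegral _ fun F hF => ?_
    have hF' : Measurable fun q : Data k n × Param k => F (q.1, reflectParam J (r ^ 2) q.1 q.2) :=
      hF.comp (measurable_fst.prodMk hT)
    rw [Measure.lintegral_compProd hF, lintegral_map hF measurable_swap]
    have h0 := h.lintegral_reflectParam (P := P) (n := n) hJ hr hr0 (hF.comp measurable_swap)
    simp only [Function.comp_apply] at h0
    rw [← h0]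
    have h1 : ∀ D, ∫⁻ θ, F (D, θ) ∂(η D)
        = ∫⁻ θ, F (D, reflectParam J (r ^ 2) D θ) ∂(posterior (dataKernel n P) π D) := by
      intro D
      rw [hη, lintegral_map (by fun_prop) (measurable_reflectParam_apply J _ D)]
    simp_rw [h1]
    rw [← Measure.lintegral_compProd hF', compProd_posterior_eq_map_swap,
      lintegral_map hF' measurable_swap]
    rfl
  filter_upwards [ae_eq_posterior_of_compProd_eq key] with D hD
  rw [← hη, hD]

end Posterior

/-! ### The optimal posterior loss -/

theorem lintegral_add_sq_gaussianReal (c : ℝ) (v : ℝ≥0) :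
    ∫⁻ e, ENNReal.ofReal ((c + e) ^ 2) ∂(gaussianReal 0 v) = ENNReal.ofReal (c ^ 2) + v := by
  have h1 : ∫⁻ e, ENNReal.ofReal ((c + e) ^ 2) ∂(gaussianReal 0 v)
      = ∫⁻ y, ENNReal.ofReal (y ^ 2) ∂(gaussianReal c v) := by
    have h := gaussianReal_map_const_add (μ := 0) (v := v) c
    rw [zero_add] at h
    rw [← h, lintegral_map (by fun_prop) (by fun_prop)]
  have hL : MemLp (id : ℝ → ℝ) 2 (gaussianReal c v) := memLp_id_gaussianReal 2
  have h2 := variance_eq_sub hL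
  simp only [variance_id_gaussianReal, Pi.pow_apply, id_eq, integral_id_gaussianReal] at h2
  rw [h1, ← ofReal_integral_eq_lintegral_ofReal (by simpa using hL.integrable_sq)
    (ae_of_all _ fun _ => sq_nonneg _), ← ENNReal.ofReal_coe_nnreal,
    ← ENNReal.ofReal_add (sq_nonneg _) (NNReal.coe_nonneg _)]
  congr 1
  linarith

section Loss

variable {k n : ℕ} {P : Measure (Cov k)} [IsProbabilityMeasure P]

theorem loss_eq {f : Cov k → ℝ} (hf : Measurable f) (θ : Param k) :
    loss P f θ = ∫⁻ x, ENNReal.ofReal ((inner ℝ x θ.1 - f x) ^ 2) ∂P + θ.2 := by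
  rw [loss, dgp, lintegral_map (by fun_prop) (by fun_prop), lintegral_prod _ (by fun_prop)]
  have h : ∀ x, ∫⁻ e, ENNReal.ofReal ((inner ℝ x θ.1 + e - f x) ^ 2) ∂(gaussianReal 0 θ.2)
      = ENNReal.ofReal ((inner ℝ x θ.1 - f x) ^ 2) + θ.2 := by
    intro x
    rw [← lintegral_add_sq_gaussianReal]
    congr with e
    ring_nf
  simp_rw [h]
  rw [lintegral_add_right _ measurable_const]
  simp

theorem measurable_loss {f : Cov k → ℝ} (hf : Measurable f) : Measurable (loss P f) := by
  have h : Measurable fun q : Param k × Cov k =>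
      ENNReal.ofReal ((inner ℝ q.2 q.1.1 - f q.2) ^ 2) := by fun_prop
  have h2 : loss P f = fun θ => ∫⁻ x, ENNReal.ofReal ((inner ℝ x θ.1 - f x) ^ 2) ∂P + θ.2 :=
    funext (loss_eq hf)
  rw [h2]
  exact h.lintegral_prod_right'.add (by fun_prop)

/-- The parallelogram inequality behind the optimality of the centre of symmetry `b` of the
posterior. -/
theorem two_mul_loss_le {f : Cov k → ℝ} (hf : Measurable f) (b : Cov k) (θ : Param k) :
    2 * loss P (fun x => inner ℝ x b) θ ≤ loss P f θ + loss P f ((2 : ℝ) • b - θ.1, θ.2) := by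
  rw [loss_eq hf, loss_eq hf, loss_eq (by fun_prop), mul_add, ← lintegral_const_mul _ (by fun_prop)]
  have h : ∫⁻ x, 2 * ENNReal.ofReal ((inner ℝ x θ.1 - inner ℝ x b) ^ 2) ∂P
      ≤ ∫⁻ x, ENNReal.ofReal ((inner ℝ x θ.1 - f x) ^ 2) ∂P
        + ∫⁻ x, ENNReal.ofReal ((inner ℝ x ((2 : ℝ) • b - θ.1) - f x) ^ 2) ∂P := by
    rw [← lintegral_add_left (by fun_prop)]
    refine lintegral_mono fun x => ?_
    rw [← ENNReal.ofReal_add (sq_nonneg _) (sq_nonneg _), two_mul,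
      ← ENNReal.ofReal_add (sq_nonneg _) (sq_nonneg _)]
    refine ENNReal.ofReal_le_ofReal ?_
    rw [inner_sub_right, inner_smul_right]
    nlinarith [sq_nonneg (inner ℝ x b - f x)]
  calc _ ≤ _ := add_le_add_left h _
    _ = _ := by ring

variable {a b : ℝ} {γ : ℝ≥0} {π : Measure (Param k)} [IsProbabilityMeasure π]
  {J : Finset (Fin k)} {r : ℝ}

/-- The optimal prediction function is linear, with the ridge estimator as coefficients. -/
theorem HasNIGForm.posteriorLoss_eq (h : HasNIGForm a b γ π) (hJ : model π = J)
    (hr : r = Real.sqrt (γ * J.card)) (hr0 : 0 < r) :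
    ∀ᵐ D ∂(marginal n P π), posteriorLoss P π D
      = ∫⁻ θ, loss P (fun x => inner ℝ x (zeroExtend J (ridgeEstimate J (r ^ 2) D))) θ
          ∂(posterior (dataKernel n P) π D) := by
  filter_upwards [h.posterior_reflectParam (P := P) (n := n) hJ hr hr0] with D hD
  have hT := measurable_reflectParam_apply J (r ^ 2) D
  refine le_antisymm (iInf₂_le _ (by fun_prop)) (le_iInf₂ fun f hf => ?_)
  have hl := measurable_loss (P := P) hf
  have h1 : ∫⁻ θ, loss P f (reflectParam J (r ^ 2) D θ) ∂(posterior (dataKernel n P) π D)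
      = ∫⁻ θ, loss P f θ ∂(posterior (dataKernel n P) π D) := by
    rw [← lintegral_map hl hT, hD]
  have h2 : 2 * ∫⁻ θ, loss P (fun x => inner ℝ x (zeroExtend J (ridgeEstimate J (r ^ 2) D))) θ
        ∂(posterior (dataKernel n P) π D)
      ≤ 2 * ∫⁻ θ, loss P f θ ∂(posterior (dataKernel n P) π D) := by
    rw [← lintegral_const_mul _ (measurable_loss (by fun_prop)), two_mul (∫⁻ θ, loss P f θ ∂_)]
    nth_rewrite 2 [← h1]
    rw [← lintegral_add_left hl]
    exact lintegral_mono fun θ => two_mul_loss_le hf _ θ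
  exact (ENNReal.mul_le_mul_iff_right (by simp) (by simp)).1 h2

/-- For isotropic covariates, the ex-ante risk is the prior mean of `σ²`, inflated by the expected
trace of the inverse regularised Gram matrix. -/
theorem HasNIGForm.exAnteRisk_eq (h : HasNIGForm a b γ π) (hJ : model π = J)
    (hl : 0 < (γ : ℝ) * J.card)
    (hP : ∀ v : Cov k, ∫⁻ x, ENNReal.ofReal ((inner ℝ x v) ^ 2) ∂P = ENNReal.ofReal (‖v‖ ^ 2)) :
    exAnteRisk n P π = (∫⁻ s, (s : ℝ≥0∞) ∂(invGamma a b)) *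
      (1 + ∫⁻ X, ENNReal.ofReal ((ridgeGram (design J X) (γ * J.card))⁻¹).trace
        ∂(Measure.pi fun _ : Fin n => P)) := by
  obtain ⟨r, hr⟩ : ∃ r, r = Real.sqrt (γ * J.card) := ⟨_, rfl⟩
  have hr0 : 0 < r := hr ▸ Real.sqrt_pos.2 hl
  have hr2 : (γ : ℝ) * J.card = r ^ 2 := by rw [hr, Real.sq_sqrt hl.le]
  have hest := measurable_ridgeEstimate (n := n) J (sq_pos_of_pos hr0)
  -- `G` is the loss of the optimal prediction; its mean is taken under the joint law.
  set G : Param k × Data k n → ℝ≥0∞ := fun q =>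
    ENNReal.ofReal (‖q.1.1 - zeroExtend J (ridgeEstimate J (r ^ 2) q.2)‖ ^ 2) + q.1.2 with hG
  have hGm : Measurable G := by fun_prop
  have h1 : exAnteRisk n P π = ∫⁻ q, G q ∂(π ⊗ₘ dataKernel n P) := by
    rw [exAnteRisk, lintegral_congr_ae (h.posteriorLoss_eq hJ hr hr0)]
    have h2 : ∀ D θ, loss P (fun x => inner ℝ x (zeroExtend J (ridgeEstimate J (r ^ 2) D))) θ
        = G (θ, D) := by
      intro D θ
      rw [loss_eq (by fun_prop)]
      simp_rw [← inner_sub_right]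
      rw [hP]
    simp_rw [h2]
    have h3 := lintegral_map (μ := π ⊗ₘ dataKernel n P) (hGm.comp measurable_swap) measurable_swap
    rw [← compProd_posterior_eq_map_swap,
      Measure.lintegral_compProd (hGm.comp measurable_swap)] at h3
    exact h3
  rw [h1, h.lintegral_joint hJ hGm, ← hr, hr2, ← lintegral_mul_const _ (by fun_prop)]
  refine lintegral_congr fun s => ?_
  have hmeas : Measurable fun X : Fin n → Cov k =>
      ENNReal.ofReal ((ridgeGram (design J X) (r ^ 2))⁻¹).trace :=
    (((continuous_inv_ridgeGram (sq_pos_of_pos hr0)).comp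
      (continuous_design J)).matrix_trace).measurable.ennreal_ofReal
  have h4 : (1 : ℝ≥0∞) = ∫⁻ _X, 1 ∂(Measure.pi fun _ : Fin n => P) := by simp
  rw [h4, ← lintegral_add_left measurable_const, ← lintegral_const_mul _ (by fun_prop)]
  refine lintegral_congr fun X => ?_
  set S := ridgeGram (design J X) (r ^ 2) with hS
  set A := scoreMatrix (design J X) r with hA
  have h5 : ∀ z : J ⊕ Fin n → ℝ,
      G ((zeroExtend J ((Real.sqrt s / r) • (z ∘ Sum.inl)), s),
        sample X (zeroExtend J ((Real.sqrt s / r) • (z ∘ Sum.inl))) (Real.sqrt s • (z ∘ Sum.inr)))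
      = s * (1 + ENNReal.ofReal (∑ j, ((S⁻¹ * A) *ᵥ z) j ^ 2)) := by
    intro z
    simp only [hG]
    rw [ridgeEstimate_sample hr0, ← zeroExtend_sub, sub_sub_cancel, ← hA, ← hS, mulVec_mulVec,
      norm_sq_zeroExtend]
    simp only [Pi.smul_apply, smul_eq_mul, mul_pow, Real.sq_sqrt (NNReal.coe_nonneg s)]
    rw [← Finset.mul_sum, ENNReal.ofReal_mul (NNReal.coe_nonneg s), ENNReal.ofReal_coe_nnreal]
    ring
  simp_rw [h5]
  have h6 : Measurable fun z : J ⊕ Fin n → ℝ =>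
      ENNReal.ofReal (∑ j, ((S⁻¹ * A) *ᵥ z) j ^ 2) := by
    refine Measurable.ennreal_ofReal (Continuous.measurable ?_)
    fun_prop
  rw [lintegral_const_mul _ (by fun_prop), lintegral_add_left measurable_const,
    lintegral_sum_mulVec_sq_stdNormal]
  -- The error of the ridge estimator is `σ S⁻¹ A z`, whose mean square is `σ² tr S⁻¹`.
  have h7 : S⁻¹ * A * (S⁻¹ * A)ᵀ = S⁻¹ := by
    rw [transpose_mul, transpose_inv_ridgeGram, Matrix.mul_assoc, ← Matrix.mul_assoc A,
      scoreMatrix_mul_transpose, mul_nonsing_inv _ (isUnit_det_ridgeGram _ (sq_pos_of_pos hr0)),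
      Matrix.mul_one]
  rw [h7]
  simp

end Loss

/-! ### Stein's identity -/

section Stein

/-- **Stein's identity** for a standard normal variable. -/
theorem integral_mul_gaussianReal {h h' : ℝ → ℝ} (hd : ∀ t, HasDerivAt h (h' t) t) {C C' : ℝ}
    (hC : ∀ t, |h t| ≤ C) (hC' : ∀ t, |h' t| ≤ C') :
    ∫ t, t * h t ∂(gaussianReal 0 1) = ∫ t, h' t ∂(gaussianReal 0 1) := by
  have hhm : Measurable h := (continuous_iff_continuousAt.2 fun t => (hd t).continuousAt).measurable
  have hhm' : Measurable h' := by
    have : h' = deriv h := funext fun t => (hd t).deriv.symm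
    rw [this]; exact measurable_deriv h
  have hφ := integrable_gaussianPDFReal 0 1
  have hφd : ∀ t, HasDerivAt (gaussianPDFReal 0 1) (-t * gaussianPDFReal 0 1 t) t := by
    intro t
    have h1 : HasDerivAt (fun x : ℝ => (√(2 * Real.pi * (1 : ℝ≥0)))⁻¹ *
        Real.exp (-(x - 0) ^ 2 / (2 * (1 : ℝ≥0)))) _ t :=
      (((((hasDerivAt_id t).sub_const 0).pow 2).neg.div_const _).exp).const_mul _
    refine h1.congr_deriv ?_
    simp [gaussianPDFReal]
    ring
  have htφ : Integrable fun t : ℝ => t * gaussianPDFReal 0 1 t := by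
    have h1 := (integrable_mul_exp_neg_mul_sq (b := 1 / 2) (by norm_num)).const_mul
      (√(2 * Real.pi))⁻¹
    refine h1.congr (ae_of_all _ fun t => ?_)
    simp only [gaussianPDFReal, NNReal.coe_one, sub_zero, mul_one]
    rw [show -(1 / 2) * t ^ 2 = -t ^ 2 / 2 by ring]
    ring
  have i1 : Integrable fun t => gaussianPDFReal 0 1 t * h' t :=
    hφ.mul_bdd hhm'.aestronglyMeasurable (ae_of_all _ hC')
  have i2 : Integrable fun t => (t * gaussianPDFReal 0 1 t) * h t :=
    htφ.mul_bdd hhm.aestronglyMeasurable (ae_of_all _ hC)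
  have i3 : Integrable fun t => gaussianPDFReal 0 1 t * h t :=
    hφ.mul_bdd hhm.aestronglyMeasurable (ae_of_all _ hC)
  have key := integral_eq_zero_of_hasDerivAt_of_integrable
    (f := fun t => gaussianPDFReal 0 1 t * h t)
    (f' := fun t => gaussianPDFReal 0 1 t * h' t - (t * gaussianPDFReal 0 1 t) * h t)
    (fun t => by
      exact ((hφd t).mul (hd t)).congr_deriv (by ring)) (i1.sub i2) i3
  rw [integral_sub i1 i2, sub_eq_zero] at key
  rw [integral_gaussianReal_eq_integral_smul one_ne_zero,
    integral_gaussianReal_eq_integral_smul one_ne_zero]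
  simp only [smul_eq_mul]
  rw [key]
  congr with t
  ring

/-- Replacing one coordinate of a vector with independent coordinates by an independent copy does
not change its law. -/
theorem measurePreserving_update {κ : Type*} [Fintype κ] [DecidableEq κ] {E : κ → Type*}
    [∀ i, MeasurableSpace (E i)] (μ : ∀ i, Measure (E i)) [∀ i, IsProbabilityMeasure (μ i)]
    (i : κ) :
    MeasurePreserving (fun q : (∀ i, E i) × E i => Function.update q.1 i q.2)
      ((Measure.pi μ).prod (μ i)) (Measure.pi μ) := by
  have hm : Measurable (fun q : (∀ i, E i) × E i => Function.update q.1 i q.2) :=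
    measurable_update'
  refine ⟨hm, (Measure.pi_eq fun s hs => ?_).symm⟩
  rw [Measure.map_apply hm (MeasurableSet.univ_pi hs)]
  have h : (fun q : (∀ i, E i) × E i => Function.update q.1 i q.2) ⁻¹' Set.univ.pi s
      = (Set.univ.pi (Function.update s i Set.univ)) ×ˢ s i := by
    ext ⟨x, t⟩
    simp only [Set.mem_preimage, Set.mem_pi, Set.mem_univ, true_imp_iff, Set.mem_prod]
    constructor
    · intro h
      refine ⟨fun j => ?_, by simpa using h i⟩
      by_cases hj : j = i
      · subst hj; simp
      · simpa [hj] using h j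
    · rintro ⟨h1, h2⟩ j
      by_cases hj : j = i
      · subst hj; simpa using h2
      · simpa [hj] using h1 j
  rw [h, Measure.prod_prod, Measure.pi_pi, ← Finset.prod_erase_mul _ _ (Finset.mem_univ i),
    ← Finset.prod_erase_mul _ _ (Finset.mem_univ i)]
  simp only [Function.update_self, measure_univ, mul_one]
  congr 1
  refine Finset.prod_congr rfl fun j hj => ?_
  rw [Function.update_of_ne (Finset.ne_of_mem_erase hj)]

theorem integral_update {κ : Type*} [Fintype κ] [DecidableEq κ] {E : κ → Type*}
    [∀ i, MeasurableSpace (E i)] (μ : ∀ i, Measure (E i)) [∀ i, IsProbabilityMeasure (μ i)]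
    (i : κ) {F : (∀ i, E i) → ℝ} (hF : Integrable F (Measure.pi μ)) :
    ∫ x, F x ∂(Measure.pi μ) = ∫ x, ∫ t, F (Function.update x i t) ∂(μ i) ∂(Measure.pi μ) := by
  have hmp := measurePreserving_update μ i
  rw [← hmp.map_eq, integral_map hmp.measurable.aemeasurable
    (by rw [hmp.map_eq]; exact hF.aestronglyMeasurable), integral_prod]
  · rw [hmp.map_eq]
  · exact (hmp.integrable_comp hF.aestronglyMeasurable).2 hF

variable {ι : Type*} [Fintype ι] [DecidableEq ι]

/-- **Stein's identity** for one coordinate of a standard normal vector. -/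
theorem integral_mul_stdNormal (j : ι) {g g' : (ι → ℝ) → ℝ} (hg : Measurable g)
    (hg' : Measurable g')
    (hd : ∀ x, HasDerivAt (fun t => g (Function.update x j t)) (g' x) (x j)) {C C' : ℝ}
    (hC : ∀ x, |g x| ≤ C) (hC' : ∀ x, |g' x| ≤ C') :
    Integrable (fun x => x j * g x) (stdNormal ι) ∧
      ∫ x, x j * g x ∂(stdNormal ι) = ∫ x, g' x ∂(stdNormal ι) := by
  have h1 : Integrable (fun x : ι → ℝ => x j) (stdNormal ι) :=
    integrable_eval (μ := fun _ : ι => gaussianReal 0 1) (i := j)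
      (by simpa using (memLp_id_gaussianReal 1).integrable (by simp))
  have h2 : Integrable (fun x => x j * g x) (stdNormal ι) :=
    h1.mul_bdd hg.aestronglyMeasurable (ae_of_all _ hC)
  have h3 : Integrable g' (stdNormal ι) :=
    Integrable.of_bound hg'.aestronglyMeasurable C' (ae_of_all _ hC')
  refine ⟨h2, ?_⟩
  rw [integral_update _ j h2, integral_update _ j h3]
  refine integral_congr_ae (ae_of_all _ fun x => ?_)
  simp only [Function.update_self]
  refine integral_mul_gaussianReal (fun t => ?_) (fun t => hC _) (fun t => hC' _)
  simpa using hd (Function.update x j t)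

/-- Cauchy–Schwarz for the inner product defined by `B`, one of the vectors being a basis vector. -/
theorem mulVec_apply_sq_le {B : Matrix ι ι ℝ} (hB : B.PosDef) (x : ι → ℝ) (j : ι) :
    (B *ᵥ x) j ^ 2 ≤ B j j * (x ⬝ᵥ B *ᵥ x) := by
  have hBt : Bᵀ = B := by simpa using hB.isHermitian.eq
  have hpos : 0 < B j j := hB.diag_pos
  set c := (B *ᵥ x) j / B j j with hc
  -- Positivity at the point where the quadratic form is minimal along the line `x - c e_j`.
  have h := hB.posSemidef.dotProduct_mulVec_nonneg (x - c • Pi.single j 1)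
  have e1 : x ⬝ᵥ B *ᵥ Pi.single j 1 = (B *ᵥ x) j := by
    rw [dotProduct_mulVec, ← mulVec_transpose, hBt]; simp
  have e2 : (Pi.single j 1 : ι → ℝ) ⬝ᵥ B *ᵥ Pi.single j 1 = B j j := by simp
  have e3 : (Pi.single j 1 : ι → ℝ) ⬝ᵥ B *ᵥ x = (B *ᵥ x) j := by simp
  simp only [star_trivial, mulVec_sub, mulVec_smul, sub_dotProduct, dotProduct_sub,
    smul_dotProduct, dotProduct_smul, e1, e2, e3, smul_eq_mul] at h
  have h2 : c * B j j = (B *ᵥ x) j := by rw [hc]; field_simp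
  nlinarith [mul_nonneg hpos.le h]

/-- Stein's identity applied to `x ↦ B x / (1 + xᵀ B x)`, which is the divergence computation
behind the mean of an inverse Wishart matrix. -/
theorem integral_quadForm_div {B : Matrix ι ι ℝ} (hB : B.PosDef) :
    ∫ x, (x ⬝ᵥ B *ᵥ x) / (1 + x ⬝ᵥ B *ᵥ x) ∂(stdNormal ι)
      = ∫ x, (B.trace / (1 + x ⬝ᵥ B *ᵥ x)
          - 2 * (∑ j, (B *ᵥ x) j ^ 2) / (1 + x ⬝ᵥ B *ᵥ x) ^ 2) ∂(stdNormal ι) := by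
  have hBt : Bᵀ = B := by simpa using hB.isHermitian.eq
  have hq : ∀ x : ι → ℝ, 0 ≤ x ⬝ᵥ B *ᵥ x := fun x => by
    simpa using hB.posSemidef.dotProduct_mulVec_nonneg x
  have hqm : Measurable fun x : ι → ℝ => x ⬝ᵥ B *ᵥ x :=
    (by fun_prop : Continuous fun x : ι → ℝ => x ⬝ᵥ B *ᵥ x).measurable
  have hbm : ∀ j, Measurable fun x : ι → ℝ => (B *ᵥ x) j := fun j =>
    (by fun_prop : Continuous fun x : ι → ℝ => (B *ᵥ x) j).measurable
  set g : ι → (ι → ℝ) → ℝ := fun j x => (B *ᵥ x) j / (1 + x ⬝ᵥ B *ᵥ x) with hg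
  set g' : ι → (ι → ℝ) → ℝ := fun j x =>
    B j j / (1 + x ⬝ᵥ B *ᵥ x) - 2 * (B *ᵥ x) j ^ 2 / (1 + x ⬝ᵥ B *ᵥ x) ^ 2 with hg'
  have hgm : ∀ j, Measurable (g j) := fun j => (hbm j).div (measurable_const.add hqm)
  have hgm' : ∀ j, Measurable (g' j) := fun j =>
    (measurable_const.div (measurable_const.add hqm)).sub
      ((((hbm j).pow_const 2).const_mul 2).div ((measurable_const.add hqm).pow_const 2))
  have hd : ∀ j x, HasDerivAt (fun t => g j (Function.update x j t)) (g' j x) (x j) := by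
    intro j x
    have hu : ∀ t, Function.update x j t = x + (t - x j) • Pi.single j 1 := by
      intro t; ext i
      by_cases hi : i = j
      · subst hi; simp
      · simp [hi]
    have e1 : x ⬝ᵥ B *ᵥ Pi.single j 1 = (B *ᵥ x) j := by
      rw [dotProduct_mulVec, ← mulVec_transpose, hBt]; simp
    have e2 : (Pi.single j 1 : ι → ℝ) ⬝ᵥ B *ᵥ Pi.single j 1 = B j j := by simp
    have e3 : (Pi.single j 1 : ι → ℝ) ⬝ᵥ B *ᵥ x = (B *ᵥ x) j := by simp
    have hgu : (fun t => g j (Function.update x j t)) = fun t =>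
        ((B *ᵥ x) j + (t - x j) * B j j) /
          (1 + (x ⬝ᵥ B *ᵥ x + (t - x j) * (2 * (B *ᵥ x) j) + (t - x j) ^ 2 * B j j)) := by
      funext t
      simp only [hg, hu, mulVec_add, mulVec_smul, dotProduct_add, add_dotProduct, smul_dotProduct,
        dotProduct_smul, e1, e2, e3, smul_eq_mul, Pi.add_apply, Pi.smul_apply]
      congr 2
      · simp
      · ring
    rw [hgu]
    have d0 : HasDerivAt (fun t => t - x j) 1 (x j) := (hasDerivAt_id _).sub_const _
    have d1 := (d0.mul_const (B j j)).const_add ((B *ᵥ x) j)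
    have d2 := (((d0.mul_const (2 * (B *ᵥ x) j)).const_add (x ⬝ᵥ B *ᵥ x)).add
      ((d0.pow 2).mul_const (B j j))).const_add 1
    have h1q : (1 + x ⬝ᵥ B *ᵥ x) ≠ 0 := by linarith [hq x]
    have d3 := d1.div d2 (by simpa using h1q)
    refine d3.congr_deriv ?_
    simp [hg']
    field_simp
  have hb : ∀ j x, |g j x| ≤ Real.sqrt (B j j) := by
    intro j x
    refine Real.abs_le_sqrt ?_
    have hj : 0 < B j j := hB.diag_pos
    have h1 := hq x
    rw [hg]
    simp only [div_pow]
    rw [div_le_iff₀ (by positivity)]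
    nlinarith [mulVec_apply_sq_le hB x j, mul_nonneg hj.le h1,
      mul_nonneg hj.le (sq_nonneg (x ⬝ᵥ B *ᵥ x))]
  have hb' : ∀ j x, |g' j x| ≤ B j j + 2 * B j j := by
    intro j x
    have hj : 0 < B j j := hB.diag_pos
    have h1 := hq x
    refine (abs_sub _ _).trans (add_le_add ?_ ?_)
    · rw [abs_of_nonneg (by positivity)]
      exact div_le_self hj.le (by linarith)
    · rw [abs_of_nonneg (by positivity), div_le_iff₀ (by positivity)]
      nlinarith [mulVec_apply_sq_le hB x j, mul_nonneg hj.le h1,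
        mul_nonneg hj.le (sq_nonneg (x ⬝ᵥ B *ᵥ x))]
  have hs := fun j => integral_mul_stdNormal j (hgm j) (hgm' j) (hd j) (hb j) (hb' j)
  have hi' : ∀ j, Integrable (g' j) (stdNormal ι) := fun j =>
    Integrable.of_bound (hgm' j).aestronglyMeasurable _ (ae_of_all _ (hb' j))
  calc _ = ∫ x, ∑ j, x j * g j x ∂(stdNormal ι) := by
        refine integral_congr_ae (ae_of_all _ fun x => ?_)
        simp only [hg]
        nth_rewrite 1 [dotProduct]
        rw [Finset.sum_div]
        exact Finset.sum_congr rfl fun j _ => mul_div_assoc _ _ _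
    _ = ∑ j, ∫ x, g' j x ∂(stdNormal ι) := by
        rw [integral_finsetSum _ fun j _ => (hs j).1]
        exact Finset.sum_congr rfl fun j _ => (hs j).2
    _ = ∫ x, ∑ j, g' j x ∂(stdNormal ι) := (integral_finsetSum _ fun j _ => hi' j).symm
    _ = _ := by
        refine integral_congr_ae (ae_of_all _ fun x => ?_)
        simp only [hg', Finset.sum_sub_distrib, ← Finset.sum_div, ← Finset.mul_sum]
        rfl

end Stein

/-! ### Rank one updates -/

section ShermanMorrison

variable {ι : Type*} [Fintype ι] [DecidableEq ι]

/-- The Sherman–Morrison formula for a symmetric rank one update. -/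
theorem inv_add_vecMulVec {C : Matrix ι ι ℝ} (hC : C.PosDef) (x : ι → ℝ) :
    (C + vecMulVec x x)⁻¹
      = C⁻¹ - (1 + x ⬝ᵥ C⁻¹ *ᵥ x)⁻¹ • vecMulVec (C⁻¹ *ᵥ x) (C⁻¹ *ᵥ x) := by
  have hCu : IsUnit C.det := hC.det_pos.ne'.isUnit
  have hB : (C⁻¹).PosDef := hC.inv
  have hBt : (C⁻¹)ᵀ = C⁻¹ := by simpa using hB.isHermitian.eq
  have hq : 0 ≤ x ⬝ᵥ C⁻¹ *ᵥ x := by simpa using hB.posSemidef.dotProduct_mulVec_nonneg x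
  have hxB : x ᵥ* C⁻¹ = C⁻¹ *ᵥ x := by rw [← mulVec_transpose, hBt]
  refine inv_eq_right_inv ?_
  rw [Matrix.add_mul, Matrix.mul_sub, Matrix.mul_sub, Matrix.mul_smul, Matrix.mul_smul,
    mul_nonsing_inv _ hCu, mul_vecMulVec, mulVec_mulVec, mul_nonsing_inv _ hCu, one_mulVec,
    vecMulVec_mul, hxB, vecMulVec_mul_vecMulVec]
  set q := x ⬝ᵥ C⁻¹ *ᵥ x
  set V := vecMulVec x (C⁻¹ *ᵥ x) with hV
  have h1 : vecMulVec x (q • C⁻¹ *ᵥ x) = q • V := by rw [vecMulVec_smul]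
  have h2 : (1 + q)⁻¹ * (1 + q) = 1 := inv_mul_cancel₀ (by linarith)
  have h3 : (1 + q)⁻¹ • V + (1 + q)⁻¹ • q • V = V := by
    rw [smul_smul, ← add_smul, ← mul_one_add, h2, one_smul]
  rw [h1]
  calc _ = 1 + V - ((1 + q)⁻¹ • V + (1 + q)⁻¹ • q • V) := by abel
    _ = 1 := by rw [h3]; abel

theorem inv_add_vecMulVec_mulVec {C : Matrix ι ι ℝ} (hC : C.PosDef) (x : ι → ℝ) :
    (C + vecMulVec x x)⁻¹ *ᵥ x = (1 + x ⬝ᵥ C⁻¹ *ᵥ x)⁻¹ • (C⁻¹ *ᵥ x) := by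
  have hq : 0 ≤ x ⬝ᵥ C⁻¹ *ᵥ x := by
    simpa using hC.inv.posSemidef.dotProduct_mulVec_nonneg x
  rw [inv_add_vecMulVec hC, sub_mulVec, smul_mulVec, vecMulVec_mulVec, dotProduct_comm _ x]
  set q := x ⬝ᵥ C⁻¹ *ᵥ x
  ext i
  have : 1 + q ≠ 0 := by linarith
  simp
  field_simp
  ring

/-- Stein's identity for one row of the design matrix, the other rows contributing `C` to the Gram
matrix. -/
theorem integral_dotProduct_inv_add_vecMulVec {C : Matrix ι ι ℝ} (hC : C.PosDef) :
    ∫ x, x ⬝ᵥ (C + vecMulVec x x)⁻¹ *ᵥ x ∂(stdNormal ι)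
      = ∫ x, ((C + vecMulVec x x)⁻¹.trace * (1 - x ⬝ᵥ (C + vecMulVec x x)⁻¹ *ᵥ x)
          - ∑ j, ((C + vecMulVec x x)⁻¹ *ᵥ x) j ^ 2) ∂(stdNormal ι) := by
  have hq : ∀ x : ι → ℝ, 1 + x ⬝ᵥ C⁻¹ *ᵥ x ≠ 0 := fun x => by
    have : 0 ≤ x ⬝ᵥ C⁻¹ *ᵥ x := by
      simpa using hC.inv.posSemidef.dotProduct_mulVec_nonneg x
    linarith
  have h := integral_quadForm_div hC.inv
  convert h using 3 with x x
  · rw [inv_add_vecMulVec_mulVec hC, dotProduct_smul, smul_eq_mul, inv_mul_eq_div]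
  · have h1 := hq x
    have h2 : (C⁻¹ *ᵥ x) ⬝ᵥ (C⁻¹ *ᵥ x) = ∑ j, (C⁻¹ *ᵥ x) j ^ 2 := by simp [dotProduct, sq]
    rw [inv_add_vecMulVec_mulVec hC, inv_add_vecMulVec hC, trace_sub, trace_smul, trace_vecMulVec,
      dotProduct_smul, h2]
    simp only [Pi.smul_apply, smul_eq_mul, mul_pow, ← Finset.mul_sum]
    field_simp
    ring

end ShermanMorrison

/-! ### Traces of inverse regularised Gram matrices -/

section TraceInverse

variable {ι m : Type*} [Fintype ι] [DecidableEq ι] [Fintype m]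

omit [Fintype ι] in
theorem ridgeGram_update [DecidableEq m] (M : m → ι → ℝ) (l : ℝ) (i : m) (x : ι → ℝ) :
    ridgeGram (of (Function.update M i x)) l
      = ridgeGram (of (Function.update M i 0)) l + vecMulVec x x := by
  ext j j'
  simp only [ridgeGram, Matrix.add_apply, mul_apply, transpose_apply, of_apply, vecMulVec_apply]
  rw [← Finset.add_sum_erase _ _ (Finset.mem_univ i),
    ← Finset.add_sum_erase _ _ (Finset.mem_univ i)]
  have h : ∀ y, ∑ a ∈ Finset.univ.erase i, Function.update M i y a j * Function.update M i y a j'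
      = ∑ a ∈ Finset.univ.erase i, M a j * M a j' := fun y =>
    Finset.sum_congr rfl fun a ha => by rw [Function.update_of_ne (Finset.ne_of_mem_erase ha)]
  rw [h, h]
  simp
  ring

variable (M : Matrix m ι ℝ) {l : ℝ}

theorem posDef_inv_ridgeGram (hl : 0 < l) : ((ridgeGram M l)⁻¹).PosDef :=
  (posDef_ridgeGram M hl).inv

theorem inv_ridgeGram_mul_gram (hl : 0 < l) :
    (ridgeGram M l)⁻¹ * (Mᵀ * M) = 1 - l • (ridgeGram M l)⁻¹ := by
  have h : Mᵀ * M = ridgeGram M l - l • 1 := by simp [ridgeGram]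
  rw [h, Matrix.mul_sub, nonsing_inv_mul _ (isUnit_det_ridgeGram M hl)]
  simp

theorem sum_dotProduct_inv_ridgeGram (hl : 0 < l) :
    ∑ i, M i ⬝ᵥ (ridgeGram M l)⁻¹ *ᵥ M i
      = Fintype.card ι - l * ((ridgeGram M l)⁻¹).trace := by
  have h : ∑ i, M i ⬝ᵥ (ridgeGram M l)⁻¹ *ᵥ M i = (M * ((ridgeGram M l)⁻¹ * Mᵀ)).trace := by
    simp only [Matrix.trace, diag_apply]
    refine Finset.sum_congr rfl fun i _ => ?_
    rw [mul_apply]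
    rfl
  rw [h, trace_mul_comm, Matrix.mul_assoc, inv_ridgeGram_mul_gram M hl, trace_sub, trace_smul,
    trace_one, smul_eq_mul]

theorem sum_mulVec_sq_inv_ridgeGram (hl : 0 < l) :
    ∑ i, ∑ j, ((ridgeGram M l)⁻¹ *ᵥ M i) j ^ 2
      = ((ridgeGram M l)⁻¹).trace - l * ((ridgeGram M l)⁻¹ * (ridgeGram M l)⁻¹).trace := by
  set T := (ridgeGram M l)⁻¹ with hT
  have hTt : Tᵀ = T := transpose_inv_ridgeGram M l
  have h : ∑ i, ∑ j, (T *ᵥ M i) j ^ 2 = ((T * Mᵀ)ᵀ * (T * Mᵀ)).trace := by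
    simp only [Matrix.trace, diag_apply]
    refine Finset.sum_congr rfl fun i _ => ?_
    rw [mul_apply]
    refine Finset.sum_congr rfl fun j _ => ?_
    rw [transpose_apply, sq]
    rfl
  rw [h, trace_mul_comm, transpose_mul, hTt, transpose_transpose, Matrix.mul_assoc,
    ← Matrix.mul_assoc Mᵀ, ← Matrix.mul_assoc T, inv_ridgeGram_mul_gram M hl, ← hT, Matrix.sub_mul,
    trace_sub, Matrix.one_mul, smul_mul, trace_smul, smul_eq_mul]

theorem trace_inv_ridgeGram_nonneg (hl : 0 < l) : 0 ≤ ((ridgeGram M l)⁻¹).trace :=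
  (posDef_inv_ridgeGram M hl).posSemidef.trace_nonneg

theorem mul_trace_inv_ridgeGram_le (hl : 0 < l) :
    l * ((ridgeGram M l)⁻¹).trace ≤ Fintype.card ι := by
  have h : 0 ≤ ∑ i, M i ⬝ᵥ (ridgeGram M l)⁻¹ *ᵥ M i := Finset.sum_nonneg fun i _ => by
    simpa using (posDef_inv_ridgeGram M hl).posSemidef.dotProduct_mulVec_nonneg (M i)
  rw [sum_dotProduct_inv_ridgeGram M hl] at h
  linarith

theorem trace_sq_inv_ridgeGram_eq (l : ℝ) :
    ((ridgeGram M l)⁻¹ * (ridgeGram M l)⁻¹).trace = ∑ i, ∑ j, (ridgeGram M l)⁻¹ i j ^ 2 := by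
  set T := (ridgeGram M l)⁻¹ with hT
  have hTt : Tᵀ = T := transpose_inv_ridgeGram M l
  nth_rewrite 2 [← hTt]
  simp [Matrix.trace, mul_apply, sq]

theorem trace_sq_inv_ridgeGram_nonneg (l : ℝ) :
    0 ≤ ((ridgeGram M l)⁻¹ * (ridgeGram M l)⁻¹).trace := by
  rw [trace_sq_inv_ridgeGram_eq]
  positivity

theorem trace_sq_inv_ridgeGram_le (hl : 0 < l) :
    ((ridgeGram M l)⁻¹ * (ridgeGram M l)⁻¹).trace ≤ ((ridgeGram M l)⁻¹).trace ^ 2 := by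
  have hT := posDef_inv_ridgeGram M hl
  rw [trace_sq_inv_ridgeGram_eq, sq, Matrix.trace, Finset.sum_mul_sum]
  refine Finset.sum_le_sum fun i _ => Finset.sum_le_sum fun j _ => ?_
  have h := mulVec_apply_sq_le hT (Pi.single j 1) i
  simpa using h

theorem trace_mul_nonneg_of_posSemidef {A B : Matrix ι ι ℝ} (hA : A.PosSemidef)
    (hB : B.PosSemidef) : 0 ≤ (A * B).trace := by
  obtain ⟨C, rfl⟩ := CStarAlgebra.nonneg_iff_eq_star_mul_self.1 hA.nonneg
  rw [Matrix.mul_assoc, trace_mul_comm]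
  exact (hB.mul_mul_conjTranspose_same C).trace_nonneg

/-- Follows from the resolvent identity. -/
theorem trace_inv_ridgeGram_anti {l' : ℝ} (hl : 0 < l) (hll : l ≤ l') :
    ((ridgeGram M l')⁻¹).trace ≤ ((ridgeGram M l)⁻¹).trace := by
  have hl' : 0 < l' := hl.trans_le hll
  have h : (ridgeGram M l)⁻¹ - (ridgeGram M l')⁻¹
      = (l' - l) • ((ridgeGram M l)⁻¹ * (ridgeGram M l')⁻¹) := by
    have h1 : ridgeGram M l' - ridgeGram M l = (l' - l) • 1 := by
      simp [ridgeGram, sub_smul]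
    calc _ = (ridgeGram M l)⁻¹ * (ridgeGram M l' - ridgeGram M l) * (ridgeGram M l')⁻¹ := by
          rw [Matrix.mul_sub, Matrix.sub_mul, nonsing_inv_mul _ (isUnit_det_ridgeGram M hl),
            Matrix.mul_assoc, mul_nonsing_inv _ (isUnit_det_ridgeGram M hl'), Matrix.mul_one,
            Matrix.one_mul]
      _ = _ := by rw [h1]; simp
  have h2 := trace_mul_nonneg_of_posSemidef (posDef_inv_ridgeGram M hl).posSemidef
    (posDef_inv_ridgeGram M hl').posSemidef
  have h3 := congrArg Matrix.trace h
  rw [trace_sub, trace_smul, smul_eq_mul] at h3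
  nlinarith [mul_nonneg (sub_nonneg.2 hll) h2]

end TraceInverse

/-! ### The inverse Wishart mean -/

section InverseWishart

variable (m ι : Type*) [Fintype ι] [DecidableEq ι] [Fintype m]

/-- The law of an `m × ι` matrix with independent standard normal entries. -/
noncomputable abbrev stdNormalMatrix : Measure (m → ι → ℝ) :=
  Measure.pi fun _ : m => stdNormal ι

variable {m ι}

theorem continuous_inv_ridgeGram_of {l : ℝ} (hl : 0 < l) :
    Continuous fun M : m → ι → ℝ => (ridgeGram (of M) l)⁻¹ :=
  (continuous_inv_ridgeGram hl).comp
    (continuous_matrix fun i j => by simp only [of_apply]; fun_prop)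

theorem measurable_trace_inv_ridgeGram {l : ℝ} (hl : 0 < l) :
    Measurable fun M : m → ι → ℝ => ((ridgeGram (of M) l)⁻¹).trace :=
  (continuous_inv_ridgeGram_of hl).matrix_trace.measurable

theorem measurable_trace_sq_inv_ridgeGram {l : ℝ} (hl : 0 < l) :
    Measurable fun M : m → ι → ℝ =>
      ((ridgeGram (of M) l)⁻¹ * (ridgeGram (of M) l)⁻¹).trace :=
  ((continuous_inv_ridgeGram_of hl).matrix_mul
    (continuous_inv_ridgeGram_of hl)).matrix_trace.measurable

theorem abs_trace_inv_ridgeGram_le (M : Matrix m ι ℝ) {l : ℝ} (hl : 0 < l) :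
    |((ridgeGram M l)⁻¹).trace| ≤ Fintype.card ι / l := by
  rw [abs_of_nonneg (trace_inv_ridgeGram_nonneg M hl), le_div_iff₀ hl, mul_comm]
  exact mul_trace_inv_ridgeGram_le M hl

theorem integrable_trace_inv_ridgeGram {l : ℝ} (hl : 0 < l) :
    Integrable (fun M => ((ridgeGram (of M) l)⁻¹).trace) (stdNormalMatrix m ι) :=
  Integrable.of_bound (measurable_trace_inv_ridgeGram hl).aestronglyMeasurable _
    (ae_of_all _ fun M => abs_trace_inv_ridgeGram_le (of M) hl)

/-- The terms which separate the mean trace of `(MᵀM + l I)⁻¹` from its limit as `l` tends to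
zero. -/
noncomputable def ridgeRemainder (l : ℝ) (M : Matrix m ι ℝ) : ℝ :=
  l * ((ridgeGram M l)⁻¹).trace + l * ((ridgeGram M l)⁻¹).trace ^ 2
    + l * ((ridgeGram M l)⁻¹ * (ridgeGram M l)⁻¹).trace

theorem measurable_ridgeRemainder {l : ℝ} (hl : 0 < l) :
    Measurable fun M : m → ι → ℝ => ridgeRemainder l (of M) := by
  have h1 := measurable_trace_inv_ridgeGram (m := m) (ι := ι) hl
  have h2 := measurable_trace_sq_inv_ridgeGram (m := m) (ι := ι) hl
  unfold ridgeRemainder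
  fun_prop

theorem ridgeRemainder_nonneg (M : Matrix m ι ℝ) {l : ℝ} (hl : 0 < l) :
    0 ≤ ridgeRemainder l M := by
  have h1 := trace_inv_ridgeGram_nonneg M hl
  have h2 := trace_sq_inv_ridgeGram_nonneg M l
  unfold ridgeRemainder
  positivity

theorem ridgeRemainder_le (M : Matrix m ι ℝ) {l : ℝ} (hl : 0 < l) :
    ridgeRemainder l M
      ≤ l * (((ridgeGram M l)⁻¹).trace + 2 * ((ridgeGram M l)⁻¹).trace ^ 2) := by
  have h := mul_le_mul_of_nonneg_left (trace_sq_inv_ridgeGram_le M hl) hl.le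
  unfold ridgeRemainder
  linarith

theorem ridgeRemainder_le_mul_trace (M : Matrix m ι ℝ) {l : ℝ} (hl : 0 < l) :
    ridgeRemainder l M
      ≤ (l + 2 * Fintype.card ι) * ((ridgeGram M l)⁻¹).trace := by
  have h1 := trace_inv_ridgeGram_nonneg M hl
  have h2 := mul_le_mul_of_nonneg_right (mul_trace_inv_ridgeGram_le M hl) h1
  have h3 := ridgeRemainder_le M hl
  nlinarith

theorem integrable_ridgeRemainder {l : ℝ} (hl : 0 < l) :
    Integrable (fun M => ridgeRemainder l (of M)) (stdNormalMatrix m ι) :=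
  ((integrable_trace_inv_ridgeGram hl).const_mul (l + 2 * Fintype.card ι)).mono'
    (measurable_ridgeRemainder hl).aestronglyMeasurable (ae_of_all _ fun M => by
      rw [Real.norm_eq_abs, abs_of_nonneg (ridgeRemainder_nonneg _ hl)]
      exact ridgeRemainder_le_mul_trace _ hl)

/-- The sum over the rows of Stein's identity. -/
theorem integral_trace_inv_ridgeGram [DecidableEq m] {l : ℝ} (hl : 0 < l) :
    ((Fintype.card m : ℝ) - Fintype.card ι - 1) *
        ∫ M, ((ridgeGram (of M) l)⁻¹).trace ∂(stdNormalMatrix m ι)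
      = Fintype.card ι - ∫ M, ridgeRemainder l (of M) ∂(stdNormalMatrix m ι) := by
  set t : (m → ι → ℝ) → ℝ := fun M => ((ridgeGram (of M) l)⁻¹).trace with ht
  set h : m → (m → ι → ℝ) → ℝ := fun i M => M i ⬝ᵥ (ridgeGram (of M) l)⁻¹ *ᵥ M i with hh
  set v : m → (m → ι → ℝ) → ℝ := fun i M =>
    ∑ j, ((ridgeGram (of M) l)⁻¹ *ᵥ M i) j ^ 2 with hv
  have hcT := continuous_inv_ridgeGram_of (m := m) (ι := ι) hl
  have hhm : ∀ i, Measurable (h i) := fun i =>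
    (Continuous.dotProduct (by fun_prop) (hcT.matrix_mulVec (by fun_prop))).measurable
  have hvm : ∀ i, Measurable (v i) := fun i => by
    have h1 : Continuous fun M : m → ι → ℝ => (ridgeGram (of M) l)⁻¹ *ᵥ M i :=
      hcT.matrix_mulVec (by fun_prop)
    have h2 : Continuous (v i) := by simp only [hv]; fun_prop
    exact h2.measurable
  have hsum : ∀ M, ∑ i, h i M = Fintype.card ι - l * t M := fun M =>
    sum_dotProduct_inv_ridgeGram (of M) hl
  have vsum : ∀ M, ∑ i, v i M
      = t M - l * ((ridgeGram (of M) l)⁻¹ * (ridgeGram (of M) l)⁻¹).trace := fun M =>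
    sum_mulVec_sq_inv_ridgeGram (of M) hl
  have t0 : ∀ M, 0 ≤ t M := fun M => trace_inv_ridgeGram_nonneg (of M) hl
  have h0 : ∀ i M, 0 ≤ h i M := fun i M => by
    simpa using (posDef_inv_ridgeGram (of M) hl).posSemidef.dotProduct_mulVec_nonneg (M i)
  have v0 : ∀ i M, 0 ≤ v i M := fun i M => Finset.sum_nonneg fun _ _ => sq_nonneg _
  have hle : ∀ i M, h i M ≤ Fintype.card ι := fun i M => by
    have h1 := Finset.single_le_sum (fun a _ => h0 a M) (Finset.mem_univ i)
    rw [hsum] at h1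
    linarith [mul_nonneg hl.le (t0 M)]
  have vle : ∀ i M, v i M ≤ t M := fun i M => by
    have h1 := Finset.single_le_sum (fun a _ => v0 a M) (Finset.mem_univ i)
    rw [vsum] at h1
    linarith [mul_nonneg hl.le (trace_sq_inv_ridgeGram_nonneg (of M) l)]
  have ti : Integrable t (stdNormalMatrix m ι) := integrable_trace_inv_ridgeGram hl
  have hi : ∀ i, Integrable (h i) (stdNormalMatrix m ι) := fun i =>
    Integrable.of_bound (hhm i).aestronglyMeasurable (Fintype.card ι) (ae_of_all _ fun M => by
      rw [Real.norm_eq_abs, abs_of_nonneg (h0 i M)]; exact hle i M)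
  have vi : ∀ i, Integrable (v i) (stdNormalMatrix m ι) := fun i =>
    ti.mono' (hvm i).aestronglyMeasurable (ae_of_all _ fun M => by
      rw [Real.norm_eq_abs, abs_of_nonneg (v0 i M)]; exact vle i M)
  have gi : ∀ i, Integrable (fun M => t M * (1 - h i M) - v i M) (stdNormalMatrix m ι) := fun i =>
    (ti.mul_bdd (c := 1 + Fintype.card ι) (measurable_const.sub (hhm i)).aestronglyMeasurable
      (ae_of_all _ fun M => by
        refine (abs_sub _ _).trans ?_
        rw [abs_one, abs_of_nonneg (h0 i M)]
        linarith [hle i M])).sub (vi i)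
  -- Resampling row `i` leaves the contribution of the other rows to the Gram matrix fixed.
  have key : ∀ i, ∫ M, h i M ∂(stdNormalMatrix m ι)
      = ∫ M, (t M * (1 - h i M) - v i M) ∂(stdNormalMatrix m ι) := by
    intro i
    rw [integral_update _ i (hi i), integral_update _ i (gi i)]
    refine integral_congr_ae (ae_of_all _ fun M => ?_)
    have h1 := integral_dotProduct_inv_add_vecMulVec
      (posDef_ridgeGram (of (Function.update M i 0)) hl)
    simp only [← ridgeGram_update] at h1
    simpa only [hh, ht, hv, Function.update_self] using h1
  have h1 : ∫ M, ∑ i, h i M ∂(stdNormalMatrix m ι)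
      = ∫ M, ∑ i, (t M * (1 - h i M) - v i M) ∂(stdNormalMatrix m ι) := by
    rw [integral_finsetSum _ fun i _ => hi i, integral_finsetSum _ fun i _ => gi i]
    exact Finset.sum_congr rfl fun i _ => key i
  have h2 : ∀ M, ∑ i, (t M * (1 - h i M) - v i M)
      = ((Fintype.card m : ℝ) - Fintype.card ι - 1) * t M + ridgeRemainder l (of M) - l * t M := by
    intro M
    rw [Finset.sum_sub_distrib, ← Finset.mul_sum, Finset.sum_sub_distrib, hsum, vsum,
      ridgeRemainder]
    simp only [Finset.sum_const, Finset.card_univ, nsmul_eq_mul, mul_one, ht]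
    ring
  simp only [h2, hsum] at h1
  have ri := integrable_ridgeRemainder (m := m) (ι := ι) hl
  rw [integral_sub (integrable_const _) (ti.const_mul l),
    integral_sub (by exact (ti.const_mul _).add ri) (ti.const_mul l),
    integral_add (ti.const_mul _) ri,
    integral_const_mul, integral_const_mul, integral_const] at h1
  simp only [probReal_univ, smul_eq_mul, one_mul] at h1
  linarith

/-- The traces of `(MᵀM + l I)⁻¹`, `l > 0`, are dominated by an integrable function: they increase
as `l` decreases, and their means are bounded. -/
theorem exists_integrable_trace_inv_ridgeGram_le [DecidableEq m]
    (hc : Fintype.card ι + 1 < Fintype.card m) :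
    ∃ τ : (m → ι → ℝ) → ℝ, Integrable τ (stdNormalMatrix m ι) ∧
      ∀ᵐ M ∂(stdNormalMatrix m ι), ∀ l, 0 < l → ((ridgeGram (of M) l)⁻¹).trace ≤ τ M := by
  have hc' : (0 : ℝ) < (Fintype.card m : ℝ) - Fintype.card ι - 1 := by
    have : ((Fintype.card ι + 1 : ℕ) : ℝ) < (Fintype.card m : ℝ) := by exact_mod_cast hc
    push_cast at this
    linarith
  set C : ℝ := Fintype.card ι / ((Fintype.card m : ℝ) - Fintype.card ι - 1) with hC
  have hpos : ∀ a : ℕ, (0 : ℝ) < 1 / ((a : ℝ) + 1) := fun a => Nat.one_div_pos_of_nat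
  set F : ℕ → (m → ι → ℝ) → ℝ≥0∞ := fun a M =>
    ENNReal.ofReal ((ridgeGram (of M) (1 / ((a : ℝ) + 1)))⁻¹).trace with hF
  have hFm : ∀ a, Measurable (F a) := fun a =>
    (measurable_trace_inv_ridgeGram (hpos a)).ennreal_ofReal
  have hmono : Monotone F := fun a b hab M =>
    ENNReal.ofReal_le_ofReal (trace_inv_ridgeGram_anti _ (hpos b)
      (one_div_le_one_div_of_le (by positivity) (by gcongr)))
  have hbound : ∀ a, ∫⁻ M, F a M ∂(stdNormalMatrix m ι) ≤ ENNReal.ofReal C := by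
    intro a
    rw [← ofReal_integral_eq_lintegral_ofReal (integrable_trace_inv_ridgeGram (hpos a))
      (ae_of_all _ fun M => trace_inv_ridgeGram_nonneg (of M) (hpos a))]
    refine ENNReal.ofReal_le_ofReal ?_
    rw [hC, le_div_iff₀ hc', mul_comm, integral_trace_inv_ridgeGram (hpos a)]
    have hr : 0 ≤ ∫ M, ridgeRemainder (1 / ((a : ℝ) + 1)) (of M) ∂(stdNormalMatrix m ι) :=
      integral_nonneg fun M => ridgeRemainder_nonneg (of M) (hpos a)
    linarith
  have hsup : ∫⁻ M, ⨆ a, F a M ∂(stdNormalMatrix m ι) ≠ ∞ := by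
    rw [lintegral_iSup hFm hmono]
    exact ne_top_of_le_ne_top ENNReal.ofReal_ne_top (iSup_le hbound)
  have hsm : Measurable fun M => ⨆ a, F a M := Measurable.iSup hFm
  refine ⟨fun M => (⨆ a, F a M).toReal, integrable_toReal_of_lintegral_ne_top hsm.aemeasurable hsup,
    ?_⟩
  filter_upwards [ae_lt_top hsm hsup] with M hM l hl
  obtain ⟨a, ha⟩ := exists_nat_one_div_lt hl
  refine (trace_inv_ridgeGram_anti (of M) (hpos a) ha.le).trans ?_
  rw [← ENNReal.ofReal_le_iff_le_toReal hM.ne]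
  exact le_iSup (fun a => F a M) a

/-- The mean trace of an inverse Wishart matrix, as the limit of its regularisations. -/
theorem tendsto_lintegral_trace_inv_ridgeGram [DecidableEq m]
    (hc : Fintype.card ι + 1 < Fintype.card m) :
    Tendsto (fun l : ℝ => ∫⁻ M, ENNReal.ofReal ((ridgeGram (of M) l)⁻¹).trace
        ∂(stdNormalMatrix m ι)) (𝓝[>] 0)
      (𝓝 (ENNReal.ofReal (Fintype.card ι / ((Fintype.card m : ℝ) - Fintype.card ι - 1)))) := by
  have hc' : (0 : ℝ) < (Fintype.card m : ℝ) - Fintype.card ι - 1 := by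
    have : ((Fintype.card ι + 1 : ℕ) : ℝ) < (Fintype.card m : ℝ) := by exact_mod_cast hc
    push_cast at this
    linarith
  obtain ⟨τ, hτi, hτ⟩ := exists_integrable_trace_inv_ridgeGram_le hc
  have hl0 : ∀ᶠ l : ℝ in 𝓝[>] 0, 0 < l := self_mem_nhdsWithin
  have hl1 : ∀ᶠ l : ℝ in 𝓝[>] 0, l < 1 := mem_nhdsWithin_of_mem_nhds (Iio_mem_nhds one_pos)
  have hlim : Tendsto (fun l : ℝ => ∫ M, ridgeRemainder l (of M) ∂(stdNormalMatrix m ι)) (𝓝[>] 0)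
      (𝓝 (∫ _M, 0 ∂(stdNormalMatrix m ι))) := by
    refine tendsto_integral_filter_of_dominated_convergence
      (fun M => (1 + 2 * Fintype.card ι) * τ M) ?_ ?_ (hτi.const_mul _) ?_
    · filter_upwards [hl0] with l hl using (measurable_ridgeRemainder hl).aestronglyMeasurable
    · filter_upwards [hl0, hl1] with l hl hl'
      filter_upwards [hτ] with M hM
      rw [Real.norm_eq_abs, abs_of_nonneg (ridgeRemainder_nonneg _ hl)]
      refine (ridgeRemainder_le_mul_trace _ hl).trans ?_
      exact mul_le_mul (by linarith) (hM l hl) (trace_inv_ridgeGram_nonneg _ hl) (by positivity)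
    · filter_upwards [hτ] with M hM
      have h1 : Tendsto (fun l : ℝ => l * (τ M + 2 * τ M ^ 2)) (𝓝[>] 0) (𝓝 0) := by
        have h2 : Tendsto (fun l : ℝ => l * (τ M + 2 * τ M ^ 2)) (𝓝 0)
            (𝓝 (0 * (τ M + 2 * τ M ^ 2))) := tendsto_id.mul_const _
        rw [zero_mul] at h2
        exact h2.mono_left nhdsWithin_le_nhds
      refine tendsto_of_tendsto_of_tendsto_of_le_of_le' tendsto_const_nhds h1 ?_ ?_
      · filter_upwards [hl0] with l hl using ridgeRemainder_nonneg _ hl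
      · filter_upwards [hl0] with l hl
        refine (ridgeRemainder_le _ hl).trans (mul_le_mul_of_nonneg_left ?_ hl.le)
        have h3 := hM l hl
        have h4 := trace_inv_ridgeGram_nonneg (of M) hl
        gcongr
  rw [integral_zero] at hlim
  have h1 : Tendsto (fun l : ℝ => ENNReal.ofReal
      ((Fintype.card ι - ∫ M, ridgeRemainder l (of M) ∂(stdNormalMatrix m ι))
        / ((Fintype.card m : ℝ) - Fintype.card ι - 1))) (𝓝[>] 0)
      (𝓝 (ENNReal.ofReal (Fintype.card ι / ((Fintype.card m : ℝ) - Fintype.card ι - 1)))) := by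
    refine ENNReal.tendsto_ofReal (Tendsto.div_const ?_ _)
    simpa using tendsto_const_nhds.sub hlim
  refine h1.congr' ?_
  filter_upwards [hl0] with l hl
  rw [← integral_trace_inv_ridgeGram hl, mul_div_cancel_left₀ _ hc'.ne',
    ofReal_integral_eq_lintegral_ofReal (integrable_trace_inv_ridgeGram hl)
      (ae_of_all _ fun M => trace_inv_ridgeGram_nonneg (of M) hl)]

end InverseWishart

/-! ### The limiting risk -/

section Risk

variable {k n : ℕ}

/-- The design matrix of the covariates in `J` has independent standard normal entries. -/
theorem measurePreserving_design (J : Finset (Fin k)) :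
    MeasurePreserving (fun (X : Fin n → Cov k) i (j : J) => X i j)
      (Measure.pi fun _ : Fin n => stdGaussian (Cov k)) (stdNormalMatrix (Fin n) J) := by
  refine measurePreserving_pi _ _ (f := fun _ (x : Cov k) (j : J) => x j) fun _ => ?_
  have h1 : MeasurePreserving (fun (x : Fin k → ℝ) (j : J) => x j) (stdNormal (Fin k))
      (stdNormal J) := by
    convert measurePreserving_fst.comp
      (measurePreserving_piEquivPiSubtypeProd (fun _ : Fin k => gaussianReal 0 1) (· ∈ J))
    rfl
  refine ⟨by fun_prop, ?_⟩
  rw [← map_pi_eq_stdGaussian, Measure.map_map (by fun_prop) (by fun_prop)]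
  exact h1.map_eq

variable {a b : ℝ} {J : Finset (Fin k)}

theorem HasNIGForm.exAnteRisk_eq_of_stdGaussian (ha : 1 < a) (hb : 0 < b) {γ : ℝ≥0}
    {π : Measure (Param k)} [IsProbabilityMeasure π] (h : HasNIGForm a b γ π) (hJ : model π = J)
    (hl : 0 < (γ : ℝ) * J.card) :
    exAnteRisk n (stdGaussian (Cov k)) π = ENNReal.ofReal (b / (a - 1)) *
      (1 + ∫⁻ M, ENNReal.ofReal ((ridgeGram (of M) (γ * J.card))⁻¹).trace
        ∂(stdNormalMatrix (Fin n) J)) := by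
  rw [h.exAnteRisk_eq hJ hl lintegral_inner_sq_stdGaussian, lintegral_invGamma ha hb,
    ← (measurePreserving_design J).lintegral_comp
      (measurable_trace_inv_ridgeGram hl).ennreal_ofReal]
  rfl

theorem tendsto_exAnteRisk (ha : 1 < a) (hb : 0 < b) (hJ : J.Nonempty) (hn : J.card + 1 < n)
    (π : ℝ≥0 → Measure (Param k)) [∀ γ, IsProbabilityMeasure (π γ)]
    (h : ∀ γ, 0 < γ → HasNIGForm a b γ (π γ) ∧ model (π γ) = J) :
    Tendsto (fun γ => exAnteRisk n (stdGaussian (Cov k)) (π γ)) (𝓝[>] 0)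
      (𝓝 (ENNReal.ofReal (b / (a - 1) * (1 + (J.card : ℝ) / ((n : ℝ) - (J.card : ℝ) - 1))))) := by
  have hp : (0 : ℝ) < J.card := by exact_mod_cast hJ.card_pos
  have hc : (0 : ℝ) < (n : ℝ) - J.card - 1 := by
    have : ((J.card + 1 : ℕ) : ℝ) < (n : ℝ) := by exact_mod_cast hn
    push_cast at this
    linarith
  have hba : 0 < b / (a - 1) := div_pos hb (by linarith)
  have hγ0 : ∀ᶠ γ : ℝ≥0 in 𝓝[>] 0, 0 < γ := self_mem_nhdsWithin
  have hl : Tendsto (fun γ : ℝ≥0 => (γ : ℝ) * J.card) (𝓝[>] 0) (𝓝[>] 0) := by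
    refine tendsto_nhdsWithin_iff.2 ⟨?_, ?_⟩
    · have h1 : Tendsto (fun γ : ℝ≥0 => (γ : ℝ) * J.card) (𝓝 0) (𝓝 (((0 : ℝ≥0) : ℝ) * J.card)) :=
        (by fun_prop : Continuous fun γ : ℝ≥0 => (γ : ℝ) * J.card).tendsto 0
      rw [NNReal.coe_zero, zero_mul] at h1
      exact h1.mono_left nhdsWithin_le_nhds
    · filter_upwards [hγ0] with γ hγ
      exact mul_pos (NNReal.coe_pos.2 hγ) hp
  have h1 := (tendsto_lintegral_trace_inv_ridgeGram (m := Fin n) (ι := J)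
    (by simpa using hn)).comp hl
  simp only [Fintype.card_fin, Fintype.card_coe] at h1
  have h2 := ENNReal.Tendsto.const_mul (a := ENNReal.ofReal (b / (a - 1)))
    (tendsto_const_nhds (x := (1 : ℝ≥0∞)).add h1) (Or.inr ENNReal.ofReal_ne_top)
  have h3 : ENNReal.ofReal (b / (a - 1) * (1 + (J.card : ℝ) / ((n : ℝ) - (J.card : ℝ) - 1)))
      = ENNReal.ofReal (b / (a - 1)) *
        (1 + ENNReal.ofReal ((J.card : ℝ) / ((n : ℝ) - (J.card : ℝ) - 1))) := by
    rw [ENNReal.ofReal_mul hba.le, ENNReal.ofReal_add zero_le_one (by positivity),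
      ENNReal.ofReal_one]
  rw [h3]
  refine h2.congr' ?_
  filter_upwards [hγ0] with γ hγ
  rw [(h γ hγ).1.exAnteRisk_eq_of_stdGaussian ha hb (h γ hγ).2 (mul_pos (NNReal.coe_pos.2 hγ) hp)]
  rfl

theorem HasNIGForm.lintegral_snd (ha : 1 < a) (hb : 0 < b) {γ : ℝ≥0} {π : Measure (Param k)}
    (h : HasNIGForm a b γ π) :
    ∫⁻ θ, (θ.2 : ℝ≥0∞) ∂π = ENNReal.ofReal (b / (a - 1)) := by
  rw [h.lintegral_eq rfl (by fun_prop), ← lintegral_invGamma ha hb]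
  simp

theorem limit_risk_lt {c : ℝ} (hc : 0 < c) {p p' : ℕ} (hp : p' < p) (hn : p + 1 < n) :
    c * (1 + (p' : ℝ) / ((n : ℝ) - p' - 1)) < c * (1 + (p : ℝ) / ((n : ℝ) - p - 1)) := by
  have h1 : (p' : ℝ) < p := by exact_mod_cast hp
  have h2 : (0 : ℝ) < (n : ℝ) - p - 1 := by
    have : ((p + 1 : ℕ) : ℝ) < (n : ℝ) := by exact_mod_cast hn
    push_cast at this
    linarith
  have h3 : (p' : ℝ) / ((n : ℝ) - p' - 1) < (p : ℝ) / ((n : ℝ) - p - 1) :=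
    div_lt_div₀ h1 (by linarith) (by positivity) h2
  gcongr

end Risk

end ModelCompetition


open ModelCompetition
theorem mainTheorem6 {k n : ℕ} (a₀ b₀ : ℝ) (ha : 1 < a₀) (hb : 0 < b₀)
    (P : Measure (Cov k)) [IsProbabilityMeasure P]
    (hP : P = multivariateGaussian (0 : Cov k) (1 : Matrix (Fin k) (Fin k) ℝ)) :
    -- the limiting ex-ante risk of an agent with model `J`
    (∀ (J : Finset (Fin k)), J.Nonempty → J.card + 1 < n →
      ∀ (π : ℝ≥0 → Measure (Param k)) [∀ γ, IsProbabilityMeasure (π γ)],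
        (∀ γ, 0 < γ → HasNIGForm a₀ b₀ γ (π γ) ∧ model (π γ) = J) →
        (∀ γ, 0 < γ → ∫⁻ θ, (θ.2 : ℝ≥0∞) ∂(π γ) = ENNReal.ofReal (b₀ / (a₀ - 1))) ∧
        Tendsto (fun γ => exAnteRisk n P (π γ)) (𝓝[>] 0)
          (𝓝 (ENNReal.ofReal
            (b₀ / (a₀ - 1) * (1 + (J.card : ℝ) / ((n : ℝ) - (J.card : ℝ) - 1)))))) ∧
    -- agents with fewer covariates have strictly lower ex-ante risk
    (∀ (J J' : Finset (Fin k)), J'.Nonempty → J'.card < J.card → J.card + 1 < n →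
      ∀ (π π' : ℝ≥0 → Measure (Param k))
        [∀ γ, IsProbabilityMeasure (π γ)] [∀ γ, IsProbabilityMeasure (π' γ)],
        (∀ γ, 0 < γ → HasNIGForm a₀ b₀ γ (π γ) ∧ model (π γ) = J) →
        (∀ γ, 0 < γ → HasNIGForm a₀ b₀ γ (π' γ) ∧ model (π' γ) = J') →
        (∀ᶠ γ in 𝓝[>] (0 : ℝ≥0), exAnteRisk n P (π' γ) < exAnteRisk n P (π γ)) ∧
        b₀ / (a₀ - 1) * (1 + (J'.card : ℝ) / ((n : ℝ) - (J'.card : ℝ) - 1)) <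
          b₀ / (a₀ - 1) * (1 + (J.card : ℝ) / ((n : ℝ) - (J.card : ℝ) - 1))) := by
  rw [multivariateGaussian_zero_one] at hP
  subst hP
  refine ⟨fun J hJ hn π _ h => ⟨fun γ hγ => (h γ hγ).1.lintegral_snd ha hb,
    tendsto_exAnteRisk ha hb hJ hn π h⟩, fun J J' hJ' hc hn π π' _ _ h h' => ?_⟩
  have hba : 0 < b₀ / (a₀ - 1) := div_pos hb (by linarith)
  have hlt := limit_risk_lt hba hc hn
  have hJ : J.Nonempty := Finset.card_pos.1 (by omega)
  refine ⟨(tendsto_exAnteRisk ha hb hJ' (by omega) π' h').eventually_lt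
    (tendsto_exAnteRisk ha hb hJ hn π h) ?_, hlt⟩
  refine (ENNReal.ofReal_lt_ofReal_iff_of_nonneg ?_).2 hlt
  have h1 : (0 : ℝ) ≤ (n : ℝ) - J'.card - 1 := by
    have : ((J'.card + 1 : ℕ) : ℝ) ≤ (n : ℝ) := by exact_mod_cast (by omega : J'.card + 1 ≤ n)
    push_cast at this
    linarith
  positivity
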